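/- Let $1\le n<m$ and let $M=M^m_w$ be a model space with pole $o$ and warping function $w$: a smooth Riemannian manifold admitting global geodesic polar coordinates $(t,\theta)$ at $o$ (the exponential map $\exp_o:T_oM\to M$ is a diffeomorphism) in which the metric on $M\setminus\{o\}$ is $dt^2+w(t)^2\,d\theta^2$, with $w$ smooth and positive on $(0,\infty)$ and $d\theta^2$ the standard metric of $\mathbb{S}^{m-1}$. Let $r$ be the distance function to $o$, $S_t=\{r=t\}$ and $\overline{B}_t=\{r\le t\}$ for $t>0$. Let $e^h$ be a radial weight on $M$: $h=f(r)$ with $f\in C^1([0,\infty))$ and $f'(0)=0$. For $t>0$ put $$H^h_n(t):=n\,\frac{w'(t)}{w(t)}+f'(t).$$ Let $\lambda_0\ge 0$ and choose $t_0>0$ such that $H^h_n(t)\ge\lambda_0$ for all $0<t\le t_0$. Let $P^n$ be a connected $n$-dimensional smooth manifold without boundary, properly immersed in $M$, with $P\subset\overline{B}_{t_0}$, and let $\overline{H}^h_P:=n\overline{H}_P-(\nabla h)^\perp$ be its $h$-mean curvature vector, where $n\overline{H}_P$ is the trace of the second fundamental form (equivalently $n\overline{H}_P=-\sum_i(\mathrm{div}_P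 N_i)N_i$ for a local orthonormal normal frame $\{N_i\}$). Suppose that $|\overline{H}^h_P|\le\lambda_0$ on $P$. Then there is $t\in(0,t_0]$ such that $H^h_n(t)=\lambda_0$, $P\subseteq S_t$, and $\overline{H}^h_P=-\lambda_0\,\nabla r$ on $P$; if $P$ is a hypersurface ($n=m-1$), then $P=S_t$. Moreover, if $H^h_n$ is decreasing (not necessarily strictly) on $(0,\infty)$ and $t_0$ is the unique positive number with $H^h_n(t_0)=\lambda_0$, then $P\subseteq S_{t_0}$, and $P=S_{t_0}$ when $P$ is a hypersurface. (Here $P$, as a subset of $M$, means the image of the immersion.) -/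

import Mathlib

open Bundle
open scoped Manifold ContDiff

noncomputable section

/-- Euclidean space `ℝᵏ` with its Euclidean norm. -/
abbrev Euc (k : ℕ) : Type := EuclideanSpace ℝ (Fin k)

namespace ModelSpace

/-- The standard basis vector `e_i` of `ℝᵏ`. -/
def stdVec {k : ℕ} (i : Fin k) : Euc k := EuclideanSpace.single i 1

/-- The matrix `(g(e_i, e_j))` of a bilinear form `g` on `ℝᵏ`. -/
def gram {k : ℕ} (g : Euc k → Euc k → ℝ) : Matrix (Fin k) (Fin k) ℝ :=
  Matrix.of fun i j => g (stdVec i) (stdVec j)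

/-- The musical isomorphism `♯` of an inner product `g` on `ℝᵏ`: the vector with components
`∑_l g^{kl} α(e_l)`, i.e. the vector `X` with `g(X, z) = α(z)` for all `z`. -/
def sharp {k : ℕ} (g : Euc k → Euc k → ℝ) (α : Euc k → ℝ) : Euc k :=
  ∑ i, (∑ l, (gram g)⁻¹ i l * α (stdVec l)) • stdVec i

/-- The Christoffel map of the Levi-Civita connection of a metric `G` on `ℝᵏ`:
`G(Γ(u,v), z) = ½ (∂_u G(v,z) + ∂_v G(u,z) - ∂_z G(u,v))` for constant vectors `u, v, z`.
Its components on basis vectors are the usual Christoffel symbols. -/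
def christoffel {k : ℕ} (G : Euc k → Euc k → Euc k → ℝ) (x u v : Euc k) : Euc k :=
  sharp (G x) fun z =>
    (fderiv ℝ (fun y => G y v z) x u + fderiv ℝ (fun y => G y u z) x v
      - fderiv ℝ (fun y => G y u v) x z) / 2

section Ambient

variable {m : ℕ} {M : Type*} [TopologicalSpace M] [ChartedSpace (Euc m) M]

/-- The radial coordinate `r` of a point in the global coordinates `Φ`. When `Φ` is a system of
geodesic polar coordinates around `o = Φ 0`, this is the Riemannian distance to `o`. -/
def radius (Φ : Diffeomorph (𝓡 m) (𝓡 m) (Euc m) M ∞) (p : M) : ℝ := ‖Φ.symm p‖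

/-- The sphere `S_t = r⁻¹(t)`. -/
def sphere (Φ : Diffeomorph (𝓡 m) (𝓡 m) (Euc m) M ∞) (t : ℝ) : Set M := {p | radius Φ p = t}

/-- The closed ball `{r ≤ t}`. -/
def closedBall (Φ : Diffeomorph (𝓡 m) (𝓡 m) (Euc m) M ∞) (t : ℝ) : Set M := {p | radius Φ p ≤ t}

/-- The tangent vector at `p` whose components in the global coordinates `Φ` are `a`. -/
def ofCoord (Φ : Diffeomorph (𝓡 m) (𝓡 m) (Euc m) M ∞) (p : M) (a : Euc m) :
    TangentSpace (𝓡 m) p :=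
  (mfderiv (𝓡 m) (𝓡 m) Φ.symm p).inverse a

variable [RiemannianBundle (fun p : M => TangentSpace (𝓡 m) p)]

/-- The Riemannian metric of `M` written in the global coordinates `Φ`, i.e. `Φ^* g`. -/
def coordMetric (Φ : Diffeomorph (𝓡 m) (𝓡 m) (Euc m) M ∞) (x u v : Euc m) : ℝ :=
  inner ℝ (mfderiv (𝓡 m) (𝓡 m) Φ x u) (mfderiv (𝓡 m) (𝓡 m) Φ x v)

/-- `M` is a model space with warping function `w` and pole `Φ 0`, and `Φ` is a system of geodesic
polar coordinates (the exponential map of the pole, after a linear isometry of `ℝᵐ` with the tangent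
space there): `Φ` is a diffeomorphism of `ℝᵐ` onto `M`, `w` is smooth and positive on `(0, ∞)`, and
away from the pole the metric is `dt² + w(t)² dθ²`. At `x ≠ 0`, with `t = ‖x‖`, the form `dt²` is
`⟪x,u⟫⟪x,v⟫/‖x‖²` and `dθ²` is `(⟪u,v⟫ - ⟪x,u⟫⟪x,v⟫/‖x‖²)/‖x‖²`. -/
structure IsModel (w : ℝ → ℝ) (Φ : Diffeomorph (𝓡 m) (𝓡 m) (Euc m) M ∞) : Prop where
  smooth : ContDiffOn ℝ ∞ w (Set.Ioi 0)
  pos : ∀ t, 0 < t → 0 < w t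
  metric : ∀ x : Euc m, x ≠ 0 → ∀ u v : Euc m,
    coordMetric Φ x u v =
      inner ℝ x u * inner ℝ x v / ‖x‖ ^ 2
        + w ‖x‖ ^ 2 * ((inner ℝ u v - inner ℝ x u * inner ℝ x v / ‖x‖ ^ 2) / ‖x‖ ^ 2)

/-- The Riemannian gradient of a function on `M`: in the coordinates `Φ` its components are
`∑_l g^{kl} ∂_l u`. -/
def grad (Φ : Diffeomorph (𝓡 m) (𝓡 m) (Euc m) M ∞) (u : M → ℝ) (p : M) : TangentSpace (𝓡 m) p :=
  ofCoord Φ p (sharp (coordMetric Φ (Φ.symm p))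
    fun z => fderiv ℝ (fun y => u (Φ y)) (Φ.symm p) z)

end Ambient

section Submanifold

variable {m n : ℕ} {M : Type*} [TopologicalSpace M] [ChartedSpace (Euc m) M]
  {P : Type*} [TopologicalSpace P] [ChartedSpace (Euc n) P]

/-- The tangent space of the immersed submanifold `φ : P → M` at `q`, inside `T_{φ(q)} M`. -/
def tangent (φ : P → M) (q : P) : Submodule ℝ (TangentSpace (𝓡 m) (φ q)) :=
  LinearMap.range (mfderiv (𝓡 n) (𝓡 m) φ q).toLinearMap

instance (φ : P → M) (q : P) : FiniteDimensional ℝ (tangent (m := m) (n := n) φ q) :=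
  haveI : FiniteDimensional ℝ (TangentSpace (𝓡 n) q) :=
    inferInstanceAs (FiniteDimensional ℝ (Euc n))
  inferInstanceAs (FiniteDimensional ℝ
    (LinearMap.range (mfderiv (𝓡 n) (𝓡 m) φ q).toLinearMap))

/-- The immersion `φ : P → M` in local coordinates: the preferred chart of `P` at `q`, and the
global coordinates `Φ` of `M`. -/
def localRep (Φ : Diffeomorph (𝓡 m) (𝓡 m) (Euc m) M ∞) (φ : P → M) (q : P) : Euc n → Euc m :=
  fun y => Φ.symm (φ ((extChartAt (𝓡 n) q).symm y))

variable [RiemannianBundle (fun p : M => TangentSpace (𝓡 m) p)]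

/-- The normal projection `X ↦ X^⊥` at `q`, with respect to the immersion `φ`. -/
def normalPart (φ : P → M) (q : P) (X : TangentSpace (𝓡 m) (φ q)) : TangentSpace (𝓡 m) (φ q) :=
  (tangent (m := m) (n := n) φ q)ᗮ.starProjection X

/-- The ambient covariant derivative `D_{∂_a} ∂_b φ` along the immersion, at `q`, for the coordinate
directions `a`, `b` of the chart of `P` at `q`: its components in the coordinates `Φ` are
`∂_a ∂_b F + Γ(∂_a F, ∂_b F)`, with `F` the local representation of the immersion. -/
def covDeriv (Φ : Diffeomorph (𝓡 m) (𝓡 m) (Euc m) M ∞) (φ : P → M) (q : P) (a b : Euc n) :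
    TangentSpace (𝓡 m) (φ q) :=
  let F := localRep Φ φ q
  let y := extChartAt (𝓡 n) q q
  ofCoord Φ (φ q) (fderiv ℝ (fun z => fderiv ℝ F z b) y a
    + christoffel (coordMetric Φ) (F y) (fderiv ℝ F y a) (fderiv ℝ F y b))

/-- The second fundamental form `II(a, b) = (D_{∂_a} ∂_b φ)^⊥` of the immersion. -/
def secondFundamentalForm (Φ : Diffeomorph (𝓡 m) (𝓡 m) (Euc m) M ∞) (φ : P → M) (q : P)
    (a b : Euc n) : TangentSpace (𝓡 m) (φ q) :=
  normalPart (n := n) φ q (covDeriv Φ φ q a b)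

/-- The metric induced on `P` by the immersion, at `q`, in the chart of `P` at `q`. -/
def inducedMetric (Φ : Diffeomorph (𝓡 m) (𝓡 m) (Euc m) M ∞) (φ : P → M) (q : P)
    (a b : Euc n) : ℝ :=
  let F := localRep Φ φ q
  let y := extChartAt (𝓡 n) q q
  coordMetric Φ (F y) (fderiv ℝ F y a) (fderiv ℝ F y b)

/-- The vector `n H̄_P` (mean curvature vector times the dimension): the trace of the second
fundamental form with respect to the induced metric. For a local orthonormal normal frame `N_i` it
equals `- ∑_i (div_P N_i) N_i`. -/
def totalMeanCurvature (Φ : Diffeomorph (𝓡 m) (𝓡 m) (Euc m) M ∞) (φ : P → M) (q : P) :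
    TangentSpace (𝓡 m) (φ q) :=
  ∑ i : Fin n, ∑ j : Fin n, (gram (inducedMetric (n := n) Φ φ q))⁻¹ i j •
    secondFundamentalForm Φ φ q (stdVec i) (stdVec j)

/-- The weighted mean curvature vector `H̄_P^h = n H̄_P - (∇h)^⊥` for the weight `e^h`. -/
def weightedMeanCurvature (Φ : Diffeomorph (𝓡 m) (𝓡 m) (Euc m) M ∞) (h : M → ℝ) (φ : P → M)
    (q : P) : TangentSpace (𝓡 m) (φ q) :=
  totalMeanCurvature (n := n) Φ φ q - normalPart (n := n) φ q (grad Φ h (φ q))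

end Submanifold

/-- The function `H_n^h(t) = n w'(t)/w(t) + f'(t)` for the weight `e^h`, `h = f(r)`. -/
def sphereCurvature (n : ℕ) (w f : ℝ → ℝ) (t : ℝ) : ℝ := n * (deriv w t / w t) + deriv f t

/-- `h = f(r)` is the exponent of a radial weight `e^h`: `f` is `C¹` on `[0, ∞)`, `f'(0) = 0`. -/
structure IsRadialWeight {m : ℕ} {M : Type*} [TopologicalSpace M] [ChartedSpace (Euc m) M]
    (Φ : Diffeomorph (𝓡 m) (𝓡 m) (Euc m) M ∞) (f : ℝ → ℝ) (h : M → ℝ) : Prop where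
  contDiff : ContDiffOn ℝ 1 f (Set.Ici 0)
  deriv_zero : derivWithin f (Set.Ici 0) 0 = 0
  eq : ∀ p, h p = f (radius Φ p)

end ModelSpace

end

/-! Let `ψ` be a primitive of `w`. In a model space the Hessian of `ψ(r)` is `w'(r)` times the
metric. Tracing it over a tangent frame of `P` and adding the derivatives along the weighted mean
curvature vector and `∇h` gives the weighted Laplacian of `ψ(r)` on `P`, namely `w(r) (H_n^h(r) +
⟨∇r, H̄_P^h⟩)`. This is nonnegative, because `|H̄_P^h| ≤ λ₀ ≤ H_n^h(r)`.

`P` is compact, being properly immersed in a ball, so `r` attains a maximum `t` on it. Here `t > 0`,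
as an immersion of positive dimension is not constant. A strong maximum principle makes `{r = t}`
open in `P`, so `r = t` on all of the connected `P`. The weighted Laplacian then vanishes, so `⟨∇r,
H̄_P^h⟩ = -H_n^h(t)`, and equality in Cauchy–Schwarz gives `H_n^h(t) = λ₀` and `H̄_P^h = -λ₀ ∇r`.
For a hypersurface the image is open and closed in the connected sphere `S_t`.

The maximum principle follows Hopf, with the Gaussian `exp(-α‖x - Y‖²)` taken in the ambient
coordinates. No Laplacian on `P` is constructed: `exists_frame_hessian_nonpos` supplies the trace
inequality at a local maximum, where differentials of test functions do not see normal projections.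
`not_isLocalMax_barrier` excludes maxima of `ψ(r)` plus a small Gaussian,
`eventually_norm_eq_of_barrier` is Hopf's argument, and `radial_weightedMeanCurvature` and
`sphereCurvature_eq_and_weightedMeanCurvature_eq` settle the equality case. -/

noncomputable section

open Filter Topology

namespace ModelSpace

/-! ### Linear algebra: index raising and traces in an orthonormal frame. -/

theorem sum_smul_stdVec {k : ℕ} (x : Euc k) : ∑ i, x i • stdVec i = x := by
  ext j
  simp [stdVec, Finset.sum_apply, Pi.single_apply]

/-- The musical isomorphism is characterised by its defining property. -/
theorem sharp_eq {k : ℕ} {E : Type*} [NormedAddCommGroup E] [InnerProductSpace ℝ E]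
    (T : Euc k →ₗ[ℝ] E) (hT : Function.Injective T) (α : Euc k → ℝ) (X : Euc k)
    (hX : ∀ z, inner ℝ (T X) (T z) = α z) :
    sharp (fun a b => inner ℝ (T a) (T b)) α = X := by
  have hli : LinearIndependent ℝ (fun i : Fin k => T (stdVec i)) := by
    have h1 := (EuclideanSpace.basisFun (Fin k) ℝ).toBasis.linearIndependent
    have h2 := h1.map' T (LinearMap.ker_eq_bot.2 hT)
    have h3 : (T ∘ (EuclideanSpace.basisFun (Fin k) ℝ).toBasis) = fun i => T (stdVec i) := by
      ext i
      simp [stdVec]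
    rwa [h3] at h2
  have hpd := Matrix.posDef_gram_of_linearIndependent hli
  have hg : gram (fun a b => inner ℝ (T a) (T b)) = Matrix.gram ℝ (fun i : Fin k => T (stdVec i)) := by
    ext i j; simp [gram, Matrix.gram]
  unfold sharp
  rw [hg]
  set A := Matrix.gram ℝ (fun i : Fin k => T (stdVec i)) with hA
  have hα : (fun l => α (stdVec l)) = A.mulVec (fun i => X i) := by
    ext l
    rw [← hX]
    conv_lhs => rw [← sum_smul_stdVec X]
    simp [Matrix.mulVec, dotProduct, A, Matrix.gram, map_sum, sum_inner, inner_smul_left,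
      real_inner_comm, mul_comm]
  have h3 : ∀ i, ∑ l, A⁻¹ i l * α (stdVec l) = X i := by
    intro i
    have : (A⁻¹.mulVec (fun l => α (stdVec l))) i = X i := by
      rw [hα, Matrix.mulVec_mulVec, Matrix.nonsing_inv_mul _ ((Matrix.isUnit_iff_isUnit_det _).1 hpd.isUnit)]
      simp
    simpa [Matrix.mulVec, dotProduct] using this
  simp_rw [h3]
  exact sum_smul_stdVec X

theorem sum_comm_four {ι κ : Type*} [Fintype ι] [Fintype κ] (F : ι → ι → κ → κ → ℝ) :
    ∑ i, ∑ j, ∑ k, ∑ l, F i j k l = ∑ k, ∑ l, ∑ i, ∑ j, F i j k l := by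
  calc _ = ∑ i, ∑ k, ∑ j, ∑ l, F i j k l := Finset.sum_congr rfl fun i _ => Finset.sum_comm
    _ = ∑ k, ∑ i, ∑ j, ∑ l, F i j k l := Finset.sum_comm
    _ = ∑ k, ∑ i, ∑ l, ∑ j, F i j k l :=
      Finset.sum_congr rfl fun k _ => Finset.sum_congr rfl fun i _ => Finset.sum_comm
    _ = _ := Finset.sum_congr rfl fun k _ => Finset.sum_comm

/-- An orthonormal frame for the inner product pulled back along `T`: traces with the inverse Gram
matrix become sums over the frame. -/
theorem exists_frame {n : ℕ} {E : Type*} [NormedAddCommGroup E] [InnerProductSpace ℝ E]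
    (T : Euc n →ₗ[ℝ] E) (hT : Function.Injective T) :
    ∃ t : Fin n → Euc n, (∀ k, inner ℝ (T (t k)) (T (t k)) = 1) ∧
      (∀ c : Euc n, ∀ b : Euc n →ₗ[ℝ] ℝ, b c ^ 2 ≤ inner ℝ (T c) (T c) * ∑ k, b (t k) ^ 2) ∧
      ∀ Q : Euc n →ₗ[ℝ] Euc n →ₗ[ℝ] ℝ,
        ∑ i, ∑ j, (gram (fun a b => inner ℝ (T a) (T b)))⁻¹ i j * Q (stdVec i) (stdVec j)
          = ∑ k, Q (t k) (t k) := by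
  let e : Euc n ≃ₗ[ℝ] LinearMap.range T := LinearEquiv.ofInjective T hT
  have : FiniteDimensional ℝ (LinearMap.range T) := Module.Finite.equiv e
  have hfr : Module.finrank ℝ (LinearMap.range T) = n := by
    rw [← e.finrank_eq]; simp
  let ob : OrthonormalBasis (Fin n) ℝ (LinearMap.range T) :=
    (stdOrthonormalBasis ℝ (LinearMap.range T)).reindex (finCongr hfr)
  have hin : ∀ a b, inner ℝ (e a) (e b) = (inner ℝ (T a) (T b) : ℝ) := fun a b => rfl
  have hc : ∀ c : Euc n, c = ∑ k, inner ℝ (ob k) (e c) • e.symm (ob k) := by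
    intro c
    apply e.injective
    rw [map_sum]
    simp only [map_smul, LinearEquiv.apply_symm_apply]
    exact (ob.sum_repr' (e c)).symm
  have hnorm : ∀ c : Euc n, (inner ℝ (T c) (T c) : ℝ) = ∑ k, (inner ℝ (ob k) (e c) : ℝ) ^ 2 := by
    intro c
    rw [← hin, real_inner_self_eq_norm_sq, ← ob.sum_sq_norm_inner_right]
    simp
  refine ⟨fun k => e.symm (ob k), ?_, ?_, ?_⟩
  · intro k
    rw [← hin]; simp [ob.orthonormal.1]
  · intro c b
    have hb : b c = ∑ k, inner ℝ (ob k) (e c) * b (e.symm (ob k)) := by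
      conv_lhs => rw [hc c]
      simp
    rw [hb, hnorm]
    exact Finset.sum_mul_sq_le_sq_mul_sq _ _ _
  · intro Q
    let S : Matrix (Fin n) (Fin n) ℝ := Matrix.of fun i k => inner ℝ (ob k) (e (stdVec i))
    have hS : gram (fun a b => inner ℝ (T a) (T b)) = S * S.transpose := by
      ext i j
      simp only [gram, Matrix.of_apply, Matrix.mul_apply, Matrix.transpose_apply, S]
      rw [← hin, ← ob.sum_inner_mul_inner]
      simp [real_inner_comm]
    have hunit : IsUnit S := by
      have : ∃ R : Matrix (Fin n) (Fin n) ℝ, R * S = 1 := by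
        refine ⟨Matrix.of fun k i => e.symm (ob k) i, ?_⟩
        ext k l
        simp only [Matrix.mul_apply, Matrix.of_apply, S]
        have h1 : (inner ℝ (ob l) (e (e.symm (ob k))) : ℝ)
            = ∑ i, e.symm (ob k) i * inner ℝ (ob l) (e (stdVec i)) := by
          conv_lhs => rw [← sum_smul_stdVec (e.symm (ob k))]
          simp [map_sum, inner_sum, inner_smul_right]
        rw [← h1]
        simp [Matrix.one_apply, orthonormal_iff_ite.1 ob.orthonormal, eq_comm]
      obtain ⟨R, hR⟩ := this
      exact IsUnit.of_mul_eq_one_right R hR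
    have hdet : IsUnit S.det := (Matrix.isUnit_iff_isUnit_det _).1 hunit
    -- From `G = S Sᵀ` one gets `Sᵀ G⁻¹ S = 1`: contraction with the inverse Gram matrix becomes the
    -- identity in the orthonormal frame.
    have h1 : S.transpose * (gram (fun a b => inner ℝ (T a) (T b)))⁻¹ * S = 1 := by
      rw [hS, Matrix.mul_inv_rev, ← Matrix.mul_assoc,
        Matrix.mul_nonsing_inv _ (by simpa using hdet), Matrix.one_mul,
        Matrix.nonsing_inv_mul _ hdet]
    have h2 : ∀ i j, Q (stdVec i) (stdVec j)
        = ∑ k, ∑ l, S i k * S j l * Q (e.symm (ob k)) (e.symm (ob l)) := by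
      intro i j
      conv_lhs => rw [hc (stdVec i), hc (stdVec j)]
      simp only [map_sum, LinearMap.sum_apply, map_smul, LinearMap.smul_apply, smul_eq_mul,
        Finset.mul_sum, S, Matrix.of_apply]
      rw [Finset.sum_comm]
      exact Finset.sum_congr rfl fun k _ => Finset.sum_congr rfl fun l _ => by ring
    have h3 : ∀ k l, ∑ i, ∑ j, (gram (fun a b => inner ℝ (T a) (T b)))⁻¹ i j * (S i k * S j l)
        = if k = l then 1 else 0 := by
      intro k l
      have := congrFun (congrFun h1 k) l
      rw [Matrix.one_apply] at this
      rw [← this]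
      simp only [Matrix.mul_apply, Matrix.transpose_apply, Finset.sum_mul]
      rw [Finset.sum_comm]
      refine Finset.sum_congr rfl fun i _ => Finset.sum_congr rfl fun j _ => by ring
    calc _ = ∑ k, ∑ l, (∑ i, ∑ j, (gram (fun a b => inner ℝ (T a) (T b)))⁻¹ i j * (S i k * S j l))
              * Q (e.symm (ob k)) (e.symm (ob l)) := by
          simp_rw [h2, Finset.mul_sum, Finset.sum_mul]
          rw [sum_comm_four]
          exact Finset.sum_congr rfl fun k _ => Finset.sum_congr rfl fun l _ =>
            Finset.sum_congr rfl fun i _ => Finset.sum_congr rfl fun j _ => by ring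
      _ = _ := by simp [h3]

/-! ### Tangent vectors and the metric in the global coordinates. -/

section Coordinates

variable {m : ℕ} {M : Type*} [TopologicalSpace M] [ChartedSpace (Euc m) M]

/-- `ofCoord` is built with `ContinuousLinearMap.inverse`, which is zero on non-invertible maps. The
differential of a diffeomorphism is invertible, so here it is the true inverse. -/
theorem exists_coordEquiv (Φ : Diffeomorph (𝓡 m) (𝓡 m) (Euc m) M ∞) (p : M) :
    ∃ e : TangentSpace (𝓡 m) p ≃L[ℝ] Euc m,
      (∀ X, mfderiv (𝓡 m) (𝓡 m) Φ.symm p X = e X) ∧ ∀ a, ofCoord Φ p a = e.symm a := by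
  let e : TangentSpace (𝓡 m) p ≃L[ℝ] TangentSpace (𝓡 m) (Φ.symm p) :=
    Φ.symm.mfderivToContinuousLinearEquiv (by simp) p
  have he : (e : TangentSpace (𝓡 m) p →L[ℝ] TangentSpace (𝓡 m) (Φ.symm p))
      = mfderiv (𝓡 m) (𝓡 m) Φ.symm p :=
    Φ.symm.mfderivToContinuousLinearEquiv_coe (by simp)
  refine ⟨e, fun X => by rw [← he]; rfl, fun a => ?_⟩
  unfold ofCoord
  rw [← he]
  exact DFunLike.congr_fun (ContinuousLinearMap.inverse_equiv e) a

theorem mfderiv_symm_ofCoord (Φ : Diffeomorph (𝓡 m) (𝓡 m) (Euc m) M ∞) (p : M) (a : Euc m) :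
    mfderiv (𝓡 m) (𝓡 m) Φ.symm p (ofCoord Φ p a) = a := by
  obtain ⟨e, he, he'⟩ := exists_coordEquiv Φ p
  rw [he, he']
  exact e.apply_symm_apply a

theorem ofCoord_mfderiv_symm (Φ : Diffeomorph (𝓡 m) (𝓡 m) (Euc m) M ∞) (p : M)
    (X : TangentSpace (𝓡 m) p) :
    ofCoord Φ p (mfderiv (𝓡 m) (𝓡 m) Φ.symm p X) = X := by
  obtain ⟨e, he, he'⟩ := exists_coordEquiv Φ p
  rw [he, he']
  exact e.symm_apply_apply X

theorem ofCoord_apply (Φ : Diffeomorph (𝓡 m) (𝓡 m) (Euc m) M ∞) (x a : Euc m) :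
    ofCoord Φ (Φ x) a = mfderiv (𝓡 m) (𝓡 m) Φ x a := by
  rw [← ofCoord_mfderiv_symm Φ (Φ x) (mfderiv (𝓡 m) (𝓡 m) Φ x a)]
  congr 1
  have h1 : HasMFDerivAt (𝓡 m) (𝓡 m) (Φ.symm ∘ Φ) x
      ((mfderiv (𝓡 m) (𝓡 m) Φ.symm (Φ x)).comp (mfderiv (𝓡 m) (𝓡 m) Φ x)) :=
    HasMFDerivAt.comp x (Φ.symm.mdifferentiable (by simp) _).hasMFDerivAt
      (Φ.mdifferentiable (by simp) _).hasMFDerivAt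
  have h2 : (Φ.symm ∘ Φ) = id := by ext1 y; simp
  rw [h2] at h1
  have h3 := hasMFDerivAt_unique h1 (hasMFDerivAt_id x)
  exact (DFunLike.congr_fun h3 a).symm

variable [RiemannianBundle (fun p : M => TangentSpace (𝓡 m) p)]

theorem inner_ofCoord (Φ : Diffeomorph (𝓡 m) (𝓡 m) (Euc m) M ∞) (p : M) (a b : Euc m) :
    inner ℝ (ofCoord Φ p a) (ofCoord Φ p b) = coordMetric Φ (Φ.symm p) a b := by
  obtain ⟨x, rfl⟩ := Φ.surjective p
  have hx : Φ.symm (Φ x) = x := Φ.symm_apply_apply x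
  change inner ℝ (ofCoord Φ (Φ x) a) (ofCoord Φ (Φ x) b) = coordMetric Φ (Φ.symm (Φ x)) a b
  rw [ofCoord_apply, ofCoord_apply, hx]
  rfl

theorem coordMetric_sharp_eq (Φ : Diffeomorph (𝓡 m) (𝓡 m) (Euc m) M ∞) (x : Euc m)
    (α : Euc m → ℝ) (X : Euc m) (hX : ∀ z, coordMetric Φ x X z = α z) :
    sharp (coordMetric Φ x) α = X := by
  refine sharp_eq (mfderiv (𝓡 m) (𝓡 m) Φ x).toLinearMap ?_ α X hX
  have h : Function.Injective (mfderiv (𝓡 m) (𝓡 m) Φ x) := by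
    intro a b hab
    have h2 := (ofCoord_apply Φ x a).trans (hab.trans (ofCoord_apply Φ x b).symm)
    exact (mfderiv_symm_ofCoord Φ (Φ x) a).symm.trans ((congrArg _ h2).trans
      (mfderiv_symm_ofCoord Φ (Φ x) b))
  exact h

end Coordinates

/-! ### The immersion in charts. -/

section Submanifold

variable {m n : ℕ} {M : Type*} [TopologicalSpace M] [ChartedSpace (Euc m) M]
  {P : Type*} [TopologicalSpace P] [ChartedSpace (Euc n) P]

theorem mfderiv_symm_mfderiv (Φ : Diffeomorph (𝓡 m) (𝓡 m) (Euc m) M ∞) {φ : P → M}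
    (hφ : ContMDiff (𝓡 n) (𝓡 m) ∞ φ) (q : P) (a : Euc n) :
    mfderiv (𝓡 m) (𝓡 m) Φ.symm (φ q) (mfderiv (𝓡 n) (𝓡 m) φ q a)
      = fderiv ℝ (localRep Φ φ q) (extChartAt (𝓡 n) q q) a := by
  have hd : MDifferentiableAt (𝓡 n) (𝓡 m) φ q := hφ.mdifferentiableAt (by simp)
  have hs : MDifferentiableAt (𝓡 m) (𝓡 m) Φ.symm (φ q) := Φ.symm.mdifferentiable (by simp) _
  have h1 := mfderiv_comp q hs hd
  have h2 : mfderiv (𝓡 n) (𝓡 m) (Φ.symm ∘ φ) q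
      = fderiv ℝ (localRep Φ φ q) (extChartAt (𝓡 n) q q) := by
    rw [MDifferentiableAt.mfderiv (hs.comp q hd)]
    simp only [modelWithCornersSelf_coe, Set.range_id, fderivWithin_univ]
    rfl
  rw [← h2, h1]
  rfl

theorem localRep_contDiffAt [IsManifold (𝓡 n) ∞ P] (Φ : Diffeomorph (𝓡 m) (𝓡 m) (Euc m) M ∞) {φ : P → M}
    (hφ : ContMDiff (𝓡 n) (𝓡 m) ∞ φ) (q : P) (y : Euc n) (hy : y ∈ (extChartAt (𝓡 n) q).target) :
    ContDiffAt ℝ ∞ (localRep Φ φ q) y := by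
  have h1 : ContMDiffAt (𝓡 n) (𝓡 n) ∞ (extChartAt (𝓡 n) q).symm y :=
    (contMDiffOn_extChartAt_symm (n := ∞) q).contMDiffAt
      ((isOpen_extChartAt_target q).mem_nhds hy)
  have h2 : ContMDiffAt (𝓡 n) (𝓡 m) ∞ (localRep Φ φ q) y :=
    (Φ.symm.contMDiff.comp hφ).contMDiffAt.comp y h1
  exact h2.contDiffAt

end Submanifold

/-! ### Second order conditions at a local maximum. -/

/-- A positive second derivative would make `x` a local minimum as well, so `g` would be locally
constant and its second derivative zero. -/
theorem IsLocalMax.second_deriv_nonpos {g g' : ℝ → ℝ} {c x : ℝ} (h : IsLocalMax g x)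
    (hg : ∀ᶠ s in 𝓝 x, HasDerivAt g (g' s) s) (hg' : HasDerivAt g' c x) : c ≤ 0 := by
  by_contra! hc
  have hd : deriv g =ᶠ[𝓝 x] g' := hg.mono fun s hs => hs.deriv
  have h0 : deriv g x = 0 := h.deriv_eq_zero
  have h2 : deriv (deriv g) x = c := by rw [hd.deriv_eq, hg'.deriv]
  have hmin : IsLocalMin g x :=
    isLocalMin_of_deriv_deriv_pos (by rwa [h2]) h0 hg.self_of_nhds.continuousAt
  have hconst : g =ᶠ[𝓝 x] fun _ => g x := by
    filter_upwards [h, hmin] with s h1 h2 using le_antisymm h1 h2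
  have h3 : deriv g =ᶠ[𝓝 x] fun _ => 0 := by
    have := hconst.deriv
    simpa using this
  have h4 : deriv (deriv g) x = 0 := by rw [h3.deriv_eq]; simp
  rw [h2] at h4
  exact hc.ne' h4

section Calculus

variable {E E' : Type*} [NormedAddCommGroup E] [NormedSpace ℝ E]
  [NormedAddCommGroup E'] [NormedSpace ℝ E']

/-- This is the one-variable condition along the line `y + s • a`, with the chain rule applied
twice. -/
theorem hessian_comp_nonpos {F : E → E'} {y : E} (hF : ContDiffAt ℝ 2 F y) {W : E' → ℝ}
    {W' : E' → E' →L[ℝ] ℝ} {W'' : E' →L[ℝ] E' →L[ℝ] ℝ}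
    (hW : ∀ᶠ x in 𝓝 (F y), HasFDerivAt W (W' x) x) (hW' : HasFDerivAt W' W'' (F y))
    (hmax : IsLocalMax (fun z => W (F z)) y) (a : E) :
    W'' (fderiv ℝ F y a) (fderiv ℝ F y a)
      + W' (F y) (fderiv ℝ (fun z => fderiv ℝ F z a) y a) ≤ 0 := by
  have hline : HasDerivAt (fun s : ℝ => y + s • a) a 0 := by
    simpa using ((hasDerivAt_id (0 : ℝ)).smul_const a).const_add y
  have hlineS : ∀ s : ℝ, HasDerivAt (fun s : ℝ => y + s • a) a s := fun s => by
    simpa using ((hasDerivAt_id s).smul_const a).const_add y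
  have hlim : Tendsto (fun s : ℝ => y + s • a) (𝓝 0) (𝓝 y) := by
    simpa using hline.continuousAt.tendsto
  have hFd : ∀ᶠ z in 𝓝 y, HasFDerivAt F (fderiv ℝ F z) z := by
    filter_upwards [hF.eventually (by simp)] with z hz
    exact (hz.differentiableAt (by simp)).hasFDerivAt
  have hWF : ∀ᶠ z in 𝓝 y, HasFDerivAt W (W' (F z)) (F z) := hF.continuousAt.eventually hW
  refine IsLocalMax.second_deriv_nonpos (g := fun s : ℝ => W (F (y + s • a)))
    (g' := fun s : ℝ => W' (F (y + s • a)) (fderiv ℝ F (y + s • a) a)) (x := 0) ?_ ?_ ?_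
  · have hm : ∀ᶠ z in 𝓝 y, W (F z) ≤ W (F y) := hmax
    have := hlim.eventually hm
    simpa [IsLocalMax, IsMaxFilter] using this
  · filter_upwards [hlim.eventually hFd, hlim.eventually hWF] with s h1 h2
    exact h2.comp_hasDerivAt s (h1.comp_hasDerivAt s (hlineS s))
  · have h1 : HasFDerivAt F (fderiv ℝ F y) (y + (0 : ℝ) • a) := by
      simpa using hFd.self_of_nhds
    have h2 : HasDerivAt (fun s : ℝ => F (y + s • a)) (fderiv ℝ F y a) 0 :=
      h1.comp_hasDerivAt 0 hline
    have h3 : HasDerivAt (fun s : ℝ => W' (F (y + s • a))) (W'' (fderiv ℝ F y a)) 0 := by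
      have : HasFDerivAt W' W'' (F (y + (0 : ℝ) • a)) := by simpa using hW'
      exact this.comp_hasDerivAt (0 : ℝ) h2
    have h4 : DifferentiableAt ℝ (fun z => fderiv ℝ F z a) y :=
      ((hF.fderiv_right (m := 1) (by norm_num)).differentiableAt (by simp)).clm_apply
        (differentiableAt_const a)
    have h5 : HasDerivAt (fun s : ℝ => fderiv ℝ F (y + s • a) a)
        (fderiv ℝ (fun z => fderiv ℝ F z a) y a) 0 := by
      have : HasFDerivAt (fun z => fderiv ℝ F z a) (fderiv ℝ (fun z => fderiv ℝ F z a) y)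
        (y + (0 : ℝ) • a) := by simpa using h4.hasFDerivAt
      exact this.comp_hasDerivAt (0 : ℝ) hline
    have h6 := h3.clm_apply h5
    simpa using h6

end Calculus

/-! ### The trace inequality at a maximum along an immersion. -/

section Submanifold

variable {m n : ℕ} {M : Type*} [TopologicalSpace M] [ChartedSpace (Euc m) M]
  [RiemannianBundle (fun p : M => TangentSpace (𝓡 m) p)]
  {P : Type*} [TopologicalSpace P] [ChartedSpace (Euc n) P]

/-- `X` and its normal part differ by a tangent vector. Applied to the differential of a function at
a critical point, this removes the normal projections from the curvature terms. -/
theorem apply_normalPart (φ : P → M) (q : P) (η : TangentSpace (𝓡 m) (φ q) →ₗ[ℝ] ℝ)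
    (hη : ∀ a, η (mfderiv (𝓡 n) (𝓡 m) φ q a) = 0) (X : TangentSpace (𝓡 m) (φ q)) :
    η (normalPart (n := n) φ q X) = η X := by
  have h1 := (tangent (m := m) (n := n) φ q).starProjection_add_starProjection_orthogonal X
  have h2 : (tangent (m := m) (n := n) φ q).starProjection X ∈ tangent (m := m) (n := n) φ q :=
    Submodule.starProjection_apply_mem _ _
  obtain ⟨a, ha⟩ := h2
  unfold normalPart
  conv_rhs => rw [← h1]
  rw [map_add, ← ha]
  have := hη a
  simpa using this

variable [IsManifold (𝓡 n) ∞ P]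

/-- The second order condition at a maximum of an ambient function along an immersion: the trace of
the ambient Hessian plus the derivative along the weighted mean curvature vector and along the
gradient of the weight is nonpositive. -/
theorem exists_frame_hessian_nonpos (Φ : Diffeomorph (𝓡 m) (𝓡 m) (Euc m) M ∞) (h : M → ℝ)
    {φ : P → M} (hφ : ContMDiff (𝓡 n) (𝓡 m) ∞ φ) (q : P)
    (himm : Function.Injective (mfderiv (𝓡 n) (𝓡 m) φ q))
    (Γ : Euc m →ₗ[ℝ] Euc m →ₗ[ℝ] Euc m)
    (hΓ : ∀ u v, christoffel (coordMetric Φ) (Φ.symm (φ q)) u v = Γ u v) :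
    ∃ τ : Fin n → Euc m, (∀ k, coordMetric Φ (Φ.symm (φ q)) (τ k) (τ k) = 1) ∧
      (∀ (a : Euc n) (b : Euc m →L[ℝ] ℝ),
        b (fderiv ℝ (localRep (n := n) Φ φ q) (extChartAt (𝓡 n) q q) a) ^ 2 ≤
          coordMetric Φ (Φ.symm (φ q)) (fderiv ℝ (localRep (n := n) Φ φ q) (extChartAt (𝓡 n) q q) a)
            (fderiv ℝ (localRep (n := n) Φ φ q) (extChartAt (𝓡 n) q q) a) * ∑ k, b (τ k) ^ 2) ∧
      ∀ (W : Euc m → ℝ) (W' : Euc m → Euc m →L[ℝ] ℝ) (W'' : Euc m →L[ℝ] Euc m →L[ℝ] ℝ),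
        (∀ᶠ x in 𝓝 (Φ.symm (φ q)), HasFDerivAt W (W' x) x) →
        HasFDerivAt W' W'' (Φ.symm (φ q)) →
        IsLocalMax (fun q' => W (Φ.symm (φ q'))) q →
        ∑ k, (W'' (τ k) (τ k) - W' (Φ.symm (φ q)) (Γ (τ k) (τ k)))
          + W' (Φ.symm (φ q)) (mfderiv (𝓡 m) (𝓡 m) Φ.symm (φ q)
              (weightedMeanCurvature (n := n) Φ h φ q))
          + W' (Φ.symm (φ q)) (mfderiv (𝓡 m) (𝓡 m) Φ.symm (φ q) (grad Φ h (φ q))) ≤ 0 := by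
  set F := localRep (n := n) Φ φ q with hF
  set y := extChartAt (𝓡 n) q q with hy
  have hFy : F y = Φ.symm (φ q) := by simp [hF, hy, localRep]
  have hFc : ContDiffAt ℝ ∞ F y := localRep_contDiffAt Φ hφ q y (mem_extChartAt_target q)
  let T : Euc n →ₗ[ℝ] TangentSpace (𝓡 m) (φ q) := (mfderiv (𝓡 n) (𝓡 m) φ q).toLinearMap
  have hT : ∀ a, mfderiv (𝓡 m) (𝓡 m) Φ.symm (φ q) (T a) = fderiv ℝ F y a :=
    mfderiv_symm_mfderiv Φ hφ q
  have hT' : ∀ a, ofCoord Φ (φ q) (fderiv ℝ F y a) = T a := fun a => by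
    rw [← hT]; exact ofCoord_mfderiv_symm Φ (φ q) _
  have hind : inducedMetric (n := n) Φ φ q = fun a b => inner ℝ (T a) (T b) := by
    funext a b
    rw [← hT', ← hT', inner_ofCoord, ← hFy]
    rfl
  obtain ⟨t, ht1, ht2, ht3⟩ := exists_frame T himm
  have hin : ∀ a b, coordMetric Φ (Φ.symm (φ q)) (fderiv ℝ F y a) (fderiv ℝ F y b)
      = inner ℝ (T a) (T b) := fun a b => by rw [← hT', ← hT', inner_ofCoord]
  refine ⟨fun k => fderiv ℝ F y (t k), fun k => by rw [hin, ht1], fun a b => ?_, ?_⟩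
  · rw [hin]
    exact ht2 a (b.toLinearMap ∘ₗ (fderiv ℝ F y).toLinearMap)
  intro W W' W'' hW hW' hmax
  have hmaxF : IsLocalMax (fun z => W (F z)) y := by
    have hlim : Tendsto (extChartAt (𝓡 n) q).symm (𝓝 y) (𝓝 q) := by
      have := (continuousAt_extChartAt_symm (I := 𝓡 n) q).tendsto
      rwa [extChartAt_to_inv] at this
    have h1 : ∀ᶠ q' in 𝓝 q, W (Φ.symm (φ q')) ≤ W (Φ.symm (φ q)) := hmax
    have h2 := hlim.eventually h1
    rw [← hFy] at h2
    exact h2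
  have hF2 : ContDiffAt ℝ 2 F y := hFc.of_le (WithTop.coe_le_coe.2 (le_top : (2 : ℕ∞) ≤ ⊤))
  have hFd : HasFDerivAt F (fderiv ℝ F y) y := (hF2.differentiableAt (by simp)).hasFDerivAt
  rw [← hFy] at hW hW' ⊢
  have hcrit : ∀ a, W' (F y) (fderiv ℝ F y a) = 0 := by
    intro a
    have h1 : HasFDerivAt (fun z => W (F z)) ((W' (F y)).comp (fderiv ℝ F y)) y :=
      hW.self_of_nhds.comp y hFd
    have h2 := hmaxF.hasFDerivAt_eq_zero h1
    exact DFunLike.congr_fun h2 a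
  let η : TangentSpace (𝓡 m) (φ q) →ₗ[ℝ] ℝ :=
    (W' (F y)).toLinearMap ∘ₗ (mfderiv (𝓡 m) (𝓡 m) Φ.symm (φ q)).toLinearMap
  have hη : ∀ a, η (mfderiv (𝓡 n) (𝓡 m) φ q a) = 0 := fun a =>
    (congrArg (W' (F y)) (hT a)).trans (hcrit a)
  have hηN := apply_normalPart φ q η hη
  have hηcoord : ∀ a, η (ofCoord Φ (φ q) a) = W' (F y) a := fun a =>
    congrArg (W' (F y)) (mfderiv_symm_ofCoord Φ (φ q) a)
  have hD2 : DifferentiableAt ℝ (fderiv ℝ F) y :=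
    (hF2.fderiv_right (m := 1) (by norm_num)).differentiableAt (by simp)
  have hD : ∀ a b, fderiv ℝ (fun z => fderiv ℝ F z b) y a = fderiv ℝ (fderiv ℝ F) y a b := by
    intro a b
    rw [fderiv_clm_apply hD2 (differentiableAt_const b)]
    simp
  -- `Q` is the second fundamental form paired with the differential of `W`. The Christoffel terms
  -- of its trace cancel those of the ambient Hessian, leaving the Euclidean second derivative of `W
  -- ∘ F`.
  let Q : Euc n →ₗ[ℝ] Euc n →ₗ[ℝ] ℝ := LinearMap.mk₂ ℝ
    (fun a b => W' (F y) (fderiv ℝ (fderiv ℝ F) y a b + Γ (fderiv ℝ F y a) (fderiv ℝ F y b)))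
    (by intros; simp; ring) (by intros; simp; ring) (by intros; simp; ring)
    (by intros; simp; ring)
  have hQ : ∀ a b, η (secondFundamentalForm (n := n) Φ φ q a b) = Q a b := by
    intro a b
    unfold secondFundamentalForm
    rw [hηN]
    have : covDeriv (n := n) Φ φ q a b = ofCoord Φ (φ q) (fderiv ℝ (fderiv ℝ F) y a b
        + Γ (fderiv ℝ F y a) (fderiv ℝ F y b)) := by
      rw [← hD, ← hΓ, ← hFy]
      rfl
    rw [this, hηcoord]
    rfl
  have htot : η (totalMeanCurvature (n := n) Φ φ q) = ∑ k, Q (t k) (t k) := by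
    rw [← ht3 Q, ← hind]
    unfold totalMeanCurvature
    simp only [map_sum, map_smul, smul_eq_mul, hQ]
  -- The `-(∇h)^⊥` inside the weighted curvature cancels the full gradient, since `η` takes the same
  -- value on both.
  have hweight : η (weightedMeanCurvature (n := n) Φ h φ q) + η (grad Φ h (φ q))
      = ∑ k, Q (t k) (t k) := by
    unfold weightedMeanCurvature
    rw [map_sub, hηN, htot]
    ring
  have hsum : ∑ k, (W'' (fderiv ℝ F y (t k)) (fderiv ℝ F y (t k))
      - W' (F y) (Γ (fderiv ℝ F y (t k)) (fderiv ℝ F y (t k)))) + ∑ k, Q (t k) (t k) ≤ 0 := by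
    rw [← Finset.sum_add_distrib]
    refine Finset.sum_nonpos fun k _ => ?_
    have := hessian_comp_nonpos hF2 hW hW' hmaxF (t k)
    rw [hD] at this
    simp only [Q, LinearMap.mk₂_apply, map_add]
    linarith
  rw [← hweight, ← add_assoc] at hsum
  exact hsum

end Submanifold

/-! ### Radial functions and the Christoffel map in closed form. -/

section Radial

variable {m : ℕ}

theorem hasFDerivAt_norm {x : Euc m} (hx : x ≠ 0) :
    HasFDerivAt (fun y : Euc m => ‖y‖) (‖x‖⁻¹ • innerSL ℝ x) x := by
  have hr : ‖x‖ ≠ 0 := norm_ne_zero_iff.2 hx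
  have h := (hasStrictFDerivAt_norm_sq x).hasFDerivAt.sqrt (by positivity)
  simp only [Real.sqrt_sq (norm_nonneg _)] at h
  refine h.congr_fderiv ?_
  ext u
  simp
  field_simp

theorem hasFDerivAt_comp_norm {x : Euc m} (hx : x ≠ 0) {g : ℝ → ℝ} {g' : ℝ}
    (hg : HasDerivAt g g' ‖x‖) :
    HasFDerivAt (fun y : Euc m => g ‖y‖) ((g' / ‖x‖) • innerSL ℝ x) x := by
  have h := HasDerivAt.comp_hasFDerivAt x hg (hasFDerivAt_norm hx)
  rwa [smul_smul, ← div_eq_mul_inv] at h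

/-- The coefficient of the Euclidean inner product in the metric `dt² + w² dθ²`. -/
def angular (w : ℝ → ℝ) (t : ℝ) : ℝ := w t ^ 2 / t ^ 2

/-- The coefficient `c` of the Christoffel map of a model metric. -/
def chrC (w : ℝ → ℝ) (t : ℝ) : ℝ := (deriv w t / w t - 1 / t) / t

/-- The coefficient `k₁` of the Christoffel map of a model metric. -/
def chrK (w : ℝ → ℝ) (t : ℝ) : ℝ :=
  -(angular w t * chrC w t) / t ^ 2 - (1 - angular w t) / t ^ 4
    - 2 * ((1 - angular w t) / t ^ 2) * chrC w t

/-- The coefficient `k₂` of the Christoffel map of a model metric. -/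
def chrL (w : ℝ → ℝ) (t : ℝ) : ℝ := (1 - angular w t) / t ^ 2 - angular w t * chrC w t

/-- The Christoffel map of a model metric, in polar coordinates. -/
def modelChristoffel (w : ℝ → ℝ) (x : Euc m) : Euc m →ₗ[ℝ] Euc m →ₗ[ℝ] Euc m :=
  LinearMap.mk₂ ℝ (fun u v => (chrC w ‖x‖ * inner ℝ x u) • v + (chrC w ‖x‖ * inner ℝ x v) • u
      + (chrK w ‖x‖ * (inner ℝ x u * inner ℝ x v) + chrL w ‖x‖ * inner ℝ u v) • x)
    (by intros; simp only [inner_add_left, inner_add_right, smul_add]; module)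
    (by intros; simp only [real_inner_smul_left, real_inner_smul_right]; module)
    (by intros; simp only [inner_add_right]; module)
    (by intros; simp only [real_inner_smul_right]; module)

theorem modelChristoffel_apply (w : ℝ → ℝ) (x u v : Euc m) :
    modelChristoffel w x u v = (chrC w ‖x‖ * inner ℝ x u) • v + (chrC w ‖x‖ * inner ℝ x v) • u
      + (chrK w ‖x‖ * (inner ℝ x u * inner ℝ x v) + chrL w ‖x‖ * inner ℝ u v) • x := rfl

end Radial

/-! ### Connection, gradient and radial Hessian of the model metric. -/

section Model

variable {m : ℕ} {M : Type*} [TopologicalSpace M] [ChartedSpace (Euc m) M]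
  [RiemannianBundle (fun p : M => TangentSpace (𝓡 m) p)]
  {w : ℝ → ℝ} {Φ : Diffeomorph (𝓡 m) (𝓡 m) (Euc m) M ∞}

theorem IsModel.hasDerivAt (hM : IsModel w Φ) {t : ℝ} (ht : 0 < t) :
    HasDerivAt w (deriv w t) t :=
  ((hM.smooth.contDiffAt (Ioi_mem_nhds ht)).differentiableAt (by simp)).hasDerivAt

theorem IsModel.coordMetric_eq (hM : IsModel w Φ) {x : Euc m} (hx : x ≠ 0) (u v : Euc m) :
    coordMetric Φ x u v = angular w ‖x‖ * inner ℝ u v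
      + (1 - angular w ‖x‖) / ‖x‖ ^ 2 * (inner ℝ x u * inner ℝ x v) := by
  have hr : ‖x‖ ≠ 0 := norm_ne_zero_iff.2 hx
  rw [hM.metric x hx]
  unfold angular
  field_simp
  ring

theorem IsModel.angular_pos (hM : IsModel w Φ) {t : ℝ} (ht : 0 < t) : 0 < angular w t := by
  have := hM.pos t ht
  unfold angular
  positivity

/-- Logarithmic differentiation: `(log (w²/t²))' = 2 (w'/w - 1/t) = 2 t c`, which is what `chrC` is
normalised for. -/
theorem IsModel.hasDerivAt_angular (hM : IsModel w Φ) {t : ℝ} (ht : 0 < t) :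
    HasDerivAt (angular w) (2 * t * angular w t * chrC w t) t := by
  have h := ((hM.hasDerivAt ht).pow 2).div (hasDerivAt_pow 2 t) (by positivity)
  have hw := hM.pos t ht
  refine HasDerivAt.congr_deriv (f := angular w) h ?_
  simp only [angular, chrC]
  field_simp
  norm_num
  ring

theorem IsModel.fderiv_coordMetric (hM : IsModel w Φ) {x : Euc m} (hx : x ≠ 0) (u v e : Euc m) :
    fderiv ℝ (fun y => coordMetric Φ y u v) x e =
      2 * angular w ‖x‖ * chrC w ‖x‖ * inner ℝ x e * inner ℝ u v
      + (-(2 * angular w ‖x‖ * chrC w ‖x‖) / ‖x‖ ^ 2 - 2 * (1 - angular w ‖x‖) / ‖x‖ ^ 4)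
          * inner ℝ x e * (inner ℝ x u * inner ℝ x v)
      + (1 - angular w ‖x‖) / ‖x‖ ^ 2 * (inner ℝ e u * inner ℝ x v + inner ℝ x u * inner ℝ e v) := by
  have hr : 0 < ‖x‖ := norm_pos_iff.2 hx
  have heq : (fun y => coordMetric Φ y u v) =ᶠ[𝓝 x] fun y => angular w ‖y‖ * inner ℝ u v
      + (1 - angular w ‖y‖) / ‖y‖ ^ 2 * (inner ℝ y u * inner ℝ y v) := by
    filter_upwards [isOpen_ne.mem_nhds hx] with y hy using hM.coordMetric_eq hy u v
  have h1 := hasFDerivAt_comp_norm hx (hM.hasDerivAt_angular hr)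
  have h2 := hasFDerivAt_comp_norm hx
    (((hM.hasDerivAt_angular hr).const_sub 1).div (hasDerivAt_pow 2 ‖x‖) (by positivity))
  have hi : ∀ u : Euc m, HasFDerivAt (fun y : Euc m => (inner ℝ y u : ℝ)) (innerSL ℝ u) x := by
    intro u
    simp_rw [real_inner_comm u]
    exact (innerSL ℝ u).hasFDerivAt
  have h3 := (h1.mul_const (inner ℝ u v)).add (h2.mul ((hi u).mul (hi v)))
  rw [heq.fderiv_eq]
  refine (DFunLike.congr_fun h3.fderiv e).trans ?_
  simp only [add_apply, smul_apply, smul_eq_mul,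
    innerSL_apply_apply, Pi.div_apply]
  rw [real_inner_comm e u, real_inner_comm e v]
  field_simp
  norm_num
  ring

/-- Write the metric as `p⟪u,v⟫ + q⟪x,u⟫⟪x,v⟫` with `q = (1 - p)/t²`. As `p + q t² = 1`, the metric
pairs `x` with `z` to `⟪x,z⟫` (Gauss lemma), so multiples of `⟪x,z⟫` are raised to multiples of `x`.
This gives `k₁ = q'/(2t) - 2qc` and `k₂ = q - pc`. -/
theorem IsModel.christoffel_eq (hM : IsModel w Φ) {x : Euc m} (hx : x ≠ 0) (u v : Euc m) :
    christoffel (coordMetric Φ) x u v = modelChristoffel w x u v := by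
  have hr : 0 < ‖x‖ := norm_pos_iff.2 hx
  refine coordMetric_sharp_eq Φ x _ _ fun z => ?_
  rw [hM.fderiv_coordMetric hx, hM.fderiv_coordMetric hx, hM.fderiv_coordMetric hx,
    hM.coordMetric_eq hx, modelChristoffel_apply]
  simp only [inner_add_left, inner_add_right, real_inner_smul_left, real_inner_smul_right,
    real_inner_self_eq_norm_sq]
  rw [real_inner_comm u v, real_inner_comm z u, real_inner_comm z v,
    chrK, chrL]
  field_simp
  ring

theorem IsModel.grad_comp_radius (hM : IsModel w Φ) {x : Euc m} (hx : x ≠ 0) {g : ℝ → ℝ} {g' : ℝ}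
    (hg : HasDerivAt g g' ‖x‖) {h : M → ℝ} (hh : ∀ p, h p = g (radius Φ p)) :
    grad Φ h (Φ x) = ofCoord Φ (Φ x) ((g' / ‖x‖) • x) := by
  have hr : 0 < ‖x‖ := norm_pos_iff.2 hx
  unfold grad
  congr 1
  rw [Φ.symm_apply_apply]
  refine coordMetric_sharp_eq Φ x _ _ fun z => ?_
  have h1 : (fun y => h (Φ y)) = fun y => g ‖y‖ := by
    funext y
    rw [hh, radius, Φ.symm_apply_apply]
  rw [h1, (hasFDerivAt_comp_norm hx hg).fderiv, hM.coordMetric_eq hx]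
  simp only [real_inner_smul_left, real_inner_smul_right, real_inner_self_eq_norm_sq,
    smul_apply, innerSL_apply_apply, smul_eq_mul]
  field_simp
  ring

/-- The Hessian of a primitive of the warping function, as a function of the radius, is a multiple
of the metric. -/
theorem IsModel.hessian_primitive (hM : IsModel w Φ) {x : Euc m} (hx : x ≠ 0) (u : Euc m) :
    ((deriv w ‖x‖ / ‖x‖ - w ‖x‖ / ‖x‖ ^ 2) / ‖x‖) * (inner ℝ x u * inner ℝ x u)
        + w ‖x‖ / ‖x‖ * inner ℝ u u
        - w ‖x‖ / ‖x‖ * inner ℝ x (modelChristoffel w x u u)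
      = deriv w ‖x‖ * coordMetric Φ x u u := by
  have hr : 0 < ‖x‖ := norm_pos_iff.2 hx
  have hw := hM.pos _ hr
  rw [hM.coordMetric_eq hx, modelChristoffel_apply]
  simp only [inner_add_right, real_inner_smul_right, real_inner_self_eq_norm_sq]
  simp only [chrK, chrL, chrC, angular]
  field_simp
  ring

end Model

/-! ### The two test functions, radial primitive and Gaussian, with their derivatives. -/

section Functions

variable {m : ℕ}

theorem exists_primitive {w : ℝ → ℝ} (hw : ContinuousOn w (Set.Ioi 0)) :
    ∃ ψ : ℝ → ℝ, ∀ t, 0 < t → HasDerivAt ψ (w t) t := by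
  -- The base point is `1` because `w` is controlled only on `(0, ∞)`.
  refine ⟨fun t => ∫ s in (1 : ℝ)..t, w s, fun t ht => ?_⟩
  refine intervalIntegral.integral_hasDerivAt_right ?_
    (hw.stronglyMeasurableAtFilter isOpen_Ioi t ht) (hw.continuousAt (Ioi_mem_nhds ht))
  refine (hw.mono fun s hs => ?_).intervalIntegrable
  exact lt_of_lt_of_le (lt_min one_pos ht) hs.1

/-- The Euclidean inner product as a continuous bilinear map. -/
def innerCLM (m : ℕ) : Euc m →L[ℝ] Euc m →L[ℝ] ℝ := innerSL ℝ

@[simp] theorem innerCLM_apply (u v : Euc m) : innerCLM m u v = inner ℝ u v := rfl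

/-- The derivative of `x ↦ ψ(‖x‖)` where `ψ' = w`. -/
def radialDeriv (w : ℝ → ℝ) (x : Euc m) : Euc m →L[ℝ] ℝ := (w ‖x‖ / ‖x‖) • innerSL ℝ x

/-- The second derivative of `x ↦ ψ(‖x‖)` where `ψ' = w`. -/
def radialHess (w : ℝ → ℝ) (x : Euc m) : Euc m →L[ℝ] Euc m →L[ℝ] ℝ :=
  (w ‖x‖ / ‖x‖) • innerCLM m
    + (((deriv w ‖x‖ / ‖x‖ - w ‖x‖ / ‖x‖ ^ 2) / ‖x‖) • innerSL ℝ x).smulRight (innerSL ℝ x)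

/-- The derivative of `x ↦ exp (-α ‖x - Y‖²)`. -/
def gaussDeriv (α : ℝ) (Y x : Euc m) : Euc m →L[ℝ] ℝ :=
  (Real.exp (-α * ‖x - Y‖ ^ 2) * (-2 * α)) • innerSL ℝ (x - Y)

/-- The second derivative of `x ↦ exp (-α ‖x - Y‖²)`. -/
def gaussHess (α : ℝ) (Y x : Euc m) : Euc m →L[ℝ] Euc m →L[ℝ] ℝ :=
  (Real.exp (-α * ‖x - Y‖ ^ 2) * (-2 * α)) • innerCLM m
    + ((Real.exp (-α * ‖x - Y‖ ^ 2) * (-2 * α) * (-2 * α)) • innerSL ℝ (x - Y)).smulRight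
      (innerSL ℝ (x - Y))

theorem hasFDerivAt_radial {w ψ : ℝ → ℝ} {x : Euc m} (hx : x ≠ 0)
    (hψ : HasDerivAt ψ (w ‖x‖) ‖x‖) :
    HasFDerivAt (fun y : Euc m => ψ ‖y‖) (radialDeriv w x) x :=
  hasFDerivAt_comp_norm hx hψ

theorem hasFDerivAt_radialDeriv {w : ℝ → ℝ} {x : Euc m} (hx : x ≠ 0)
    (hw : HasDerivAt w (deriv w ‖x‖) ‖x‖) :
    HasFDerivAt (radialDeriv w) (radialHess w x) x := by
  have hr : 0 < ‖x‖ := norm_pos_iff.2 hx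
  have h1 := hasFDerivAt_comp_norm hx (hw.div (hasDerivAt_id ‖x‖) hr.ne')
  have h2 := h1.smul ((innerCLM m).hasFDerivAt (x := x))
  refine HasFDerivAt.congr_fderiv (f := radialDeriv w) h2 ?_
  ext u v
  simp [radialHess]
  exact Or.inl (Or.inl (by field_simp))

theorem hasFDerivAt_gauss (α : ℝ) (Y x : Euc m) :
    HasFDerivAt (fun y : Euc m => Real.exp (-α * ‖y - Y‖ ^ 2)) (gaussDeriv α Y x) x := by
  have h1 := (((hasFDerivAt_id x).sub_const Y).norm_sq.const_mul (-α)).exp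
  refine h1.congr_fderiv ?_
  ext u
  simp [gaussDeriv]
  ring

theorem hasFDerivAt_gaussDeriv (α : ℝ) (Y x : Euc m) :
    HasFDerivAt (gaussDeriv α Y) (gaussHess α Y x) x := by
  have h1 := (hasFDerivAt_gauss α Y x).mul_const (-2 * α)
  have h2 : HasFDerivAt (fun y : Euc m => (innerSL ℝ (y - Y) : Euc m →L[ℝ] ℝ))
      (innerCLM m) x :=
    (innerCLM m).hasFDerivAt.comp x ((hasFDerivAt_id x).sub_const Y)
  have h3 := h1.smul h2
  refine HasFDerivAt.congr_fderiv (f := gaussDeriv α Y) h3 ?_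
  ext u v
  simp [gaussHess, gaussDeriv]
  exact Or.inl (by ring)

/-- A bound for the operator norm of the Christoffel map of a model metric at radius `t`. -/
def chrBound (w : ℝ → ℝ) (t : ℝ) : ℝ :=
  2 * |chrC w t| * t + (|chrK w t| * t ^ 2 + |chrL w t|) * t

theorem norm_modelChristoffel_le (w : ℝ → ℝ) (x u : Euc m) :
    ‖modelChristoffel w x u u‖ ≤ chrBound w ‖x‖ * ‖u‖ ^ 2 := by
  have hxu : |inner ℝ x u| ≤ ‖x‖ * ‖u‖ := abs_real_inner_le_norm x u
  rw [modelChristoffel_apply, real_inner_self_eq_norm_sq]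
  have h1 : ‖(chrC w ‖x‖ * inner ℝ x u) • u‖ ≤ |chrC w ‖x‖| * (‖x‖ * ‖u‖) * ‖u‖ := by
    rw [norm_smul, Real.norm_eq_abs, abs_mul]
    gcongr
  have h2 : ‖(chrK w ‖x‖ * (inner ℝ x u * inner ℝ x u) + chrL w ‖x‖ * ‖u‖ ^ 2) • x‖
      ≤ (|chrK w ‖x‖| * ((‖x‖ * ‖u‖) * (‖x‖ * ‖u‖)) + |chrL w ‖x‖| * ‖u‖ ^ 2) * ‖x‖ := by
    rw [norm_smul, Real.norm_eq_abs]
    gcongr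
    refine (abs_add_le _ _).trans ?_
    rw [abs_mul, abs_mul, abs_mul, abs_of_nonneg (sq_nonneg ‖u‖)]
    gcongr
  refine (norm_add_le _ _).trans ((add_le_add (norm_add_le _ _) le_rfl).trans ?_)
  refine (add_le_add (add_le_add h1 h1) h2).trans (le_of_eq ?_)
  unfold chrBound
  ring

/-- A bound for the terms of lower order in the weighted Laplacian of a Gaussian. -/
def lowerOrderBound (n : ℕ) (w f : ℝ → ℝ) (lam : ℝ) (Y x : Euc m) : ℝ :=
  n * ((1 + 1 / angular w ‖x‖) * (1 + ‖x - Y‖ * chrBound w ‖x‖))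
    + ‖x - Y‖ * (1 + (1 + 1 / angular w ‖x‖) * lam ^ 2) + ‖x - Y‖ * |deriv f ‖x‖|

end Functions

/-! ### Metric comparison and weighted Hessian traces of the test functions. -/

section Model

variable {m : ℕ} {M : Type*} [TopologicalSpace M] [ChartedSpace (Euc m) M]
  [RiemannianBundle (fun p : M => TangentSpace (𝓡 m) p)]
  {w : ℝ → ℝ} {Φ : Diffeomorph (𝓡 m) (𝓡 m) (Euc m) M ∞}

theorem inner_sq_div_le {x : Euc m} (hx : x ≠ 0) (u : Euc m) :
    (inner ℝ x u / ‖x‖) ^ 2 ≤ ‖u‖ ^ 2 := by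
  have hr : 0 < ‖x‖ := norm_pos_iff.2 hx
  rw [sq_le_sq, abs_div, abs_norm, abs_norm, div_le_iff₀ hr, mul_comm]
  exact abs_real_inner_le_norm x u

/-- Relative to the Euclidean product the metric has eigenvalue `1` radially and `angular w ‖x‖` on
the orthogonal complement. The three comparison estimates below read off this splitting, with sums
such as `1 + 1/p` in place of maxima. -/
theorem IsModel.coordMetric_self (hM : IsModel w Φ) {x : Euc m} (hx : x ≠ 0) (u : Euc m) :
    coordMetric Φ x u u = angular w ‖x‖ * (‖u‖ ^ 2 - (inner ℝ x u / ‖x‖) ^ 2)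
      + (inner ℝ x u / ‖x‖) ^ 2 := by
  have hr : 0 < ‖x‖ := norm_pos_iff.2 hx
  rw [hM.coordMetric_eq hx, real_inner_self_eq_norm_sq]
  field_simp
  ring

theorem IsModel.norm_sq_le (hM : IsModel w Φ) {x : Euc m} (hx : x ≠ 0) (u : Euc m) :
    ‖u‖ ^ 2 ≤ (1 + 1 / angular w ‖x‖) * coordMetric Φ x u u := by
  have hp := hM.angular_pos (norm_pos_iff.2 hx)
  have h1 := inner_sq_div_le hx u
  rw [hM.coordMetric_self hx]
  set X := (inner ℝ x u / ‖x‖) ^ 2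
  have hX : 0 ≤ X := sq_nonneg _
  set p := angular w ‖x‖
  have : (1 + 1 / p) * (p * (‖u‖ ^ 2 - X) + X) = ‖u‖ ^ 2 + (p * (‖u‖ ^ 2 - X) + X / p) := by
    field_simp
    ring
  rw [this]
  have h2 : 0 ≤ p * (‖u‖ ^ 2 - X) := mul_nonneg hp.le (by linarith)
  have h3 : 0 ≤ X / p := by positivity
  linarith

theorem IsModel.coordMetric_le (hM : IsModel w Φ) {x : Euc m} (hx : x ≠ 0) (u : Euc m) :
    coordMetric Φ x u u ≤ (1 + angular w ‖x‖) * ‖u‖ ^ 2 := by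
  have hp := hM.angular_pos (norm_pos_iff.2 hx)
  have h1 := inner_sq_div_le hx u
  rw [hM.coordMetric_self hx]
  have hX : 0 ≤ (inner ℝ x u / ‖x‖) ^ 2 := sq_nonneg _
  nlinarith

theorem IsModel.inner_sq_le (hM : IsModel w Φ) {x : Euc m} (hx : x ≠ 0) (u : Euc m) :
    (inner ℝ x u / ‖x‖) ^ 2 ≤ coordMetric Φ x u u := by
  have hp := hM.angular_pos (norm_pos_iff.2 hx)
  have h1 := inner_sq_div_le hx u
  rw [hM.coordMetric_self hx]
  nlinarith

/-- Each unit frame vector contributes exactly `w'`, whatever its direction. This is why a primitive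
of `w` is used as test function rather than the radius itself. -/
theorem IsModel.radial_hessian_sum (hM : IsModel w Φ) {n : ℕ} {f : ℝ → ℝ} {x : Euc m} (hx : x ≠ 0)
    {τ : Fin n → Euc m} (hτ : ∀ k, coordMetric Φ x (τ k) (τ k) = 1) (η : Euc m) :
    ∑ k, (radialHess w x (τ k) (τ k) - radialDeriv w x (modelChristoffel w x (τ k) (τ k)))
        + radialDeriv w x η + radialDeriv w x ((deriv f ‖x‖ / ‖x‖) • x)
      = w ‖x‖ * (sphereCurvature n w f ‖x‖ + inner ℝ x η / ‖x‖) := by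
  have hr : 0 < ‖x‖ := norm_pos_iff.2 hx
  have hw := hM.pos _ hr
  have h1 : ∀ k, radialHess w x (τ k) (τ k)
      - radialDeriv w x (modelChristoffel w x (τ k) (τ k)) = deriv w ‖x‖ := by
    intro k
    have := hM.hessian_primitive hx (τ k)
    rw [hτ, mul_one] at this
    rw [← this]
    simp [radialHess, radialDeriv]
    ring
  simp only [h1, Finset.sum_const, Finset.card_univ, Fintype.card_fin, nsmul_eq_mul]
  simp only [radialDeriv, smul_apply, innerSL_apply_apply, smul_eq_mul,
    real_inner_smul_right, real_inner_self_eq_norm_sq, sphereCurvature]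
  field_simp
  ring

/-- The square of the Gaussian's gradient carries `α²`, and every other term is of order `α`. After
division by `2α exp(-α‖x - Y‖²)`, the hypothesis says that the former dominates. -/
theorem IsModel.gauss_hessian_sum_pos (hM : IsModel w Φ) {n : ℕ} {f : ℝ → ℝ} {lam α : ℝ}
    {x : Euc m} (hx : x ≠ 0) (hα : 0 < α) (Y : Euc m)
    {τ : Fin n → Euc m} (hτ : ∀ k, coordMetric Φ x (τ k) (τ k) = 1) {η : Euc m}
    (hη : coordMetric Φ x η η ≤ lam ^ 2)
    (hD : lowerOrderBound n w f lam Y x < 2 * α * ∑ k, (inner ℝ (x - Y) (τ k)) ^ 2) :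
    0 < ∑ k, (gaussHess α Y x (τ k) (τ k)
          - gaussDeriv α Y x (modelChristoffel w x (τ k) (τ k)))
        + gaussDeriv α Y x η + gaussDeriv α Y x ((deriv f ‖x‖ / ‖x‖) • x) := by
  have hr : 0 < ‖x‖ := norm_pos_iff.2 hx
  have hp := hM.angular_pos hr
  set A := 1 + 1 / angular w ‖x‖ with hA
  have hA0 : 0 ≤ A := by positivity
  have hcs : ∀ v : Euc m, inner ℝ (x - Y) v ≤ ‖x - Y‖ * ‖v‖ := fun v => real_inner_le_norm _ _
  have hτn : ∀ k, ‖τ k‖ ^ 2 ≤ A := fun k => by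
    have := hM.norm_sq_le hx (τ k)
    rwa [hτ, mul_one] at this
  have hC : 0 ≤ chrBound w ‖x‖ := by unfold chrBound; positivity
  have h1 : ∀ k, ‖τ k‖ ^ 2 - inner ℝ (x - Y) (modelChristoffel w x (τ k) (τ k))
      ≤ A * (1 + ‖x - Y‖ * chrBound w ‖x‖) := by
    intro k
    have h2 : -inner ℝ (x - Y) (modelChristoffel w x (τ k) (τ k))
        ≤ ‖x - Y‖ * (chrBound w ‖x‖ * A) := by
      rw [← inner_neg_right]
      refine (hcs _).trans ?_
      rw [norm_neg]
      gcongr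
      refine (norm_modelChristoffel_le w x (τ k)).trans ?_
      gcongr
      exact hτn k
    have := hτn k
    nlinarith
  have h2 : inner ℝ (x - Y) η ≤ ‖x - Y‖ * (1 + A * lam ^ 2) := by
    refine (hcs _).trans ?_
    gcongr
    have h3 := hM.norm_sq_le hx η
    have h4 : ‖η‖ ^ 2 ≤ A * lam ^ 2 := h3.trans (by gcongr)
    -- The bound `‖η‖ ≤ 1 + ‖η‖²` avoids a square root and explains the summand `1 + A λ²` in
    -- `lowerOrderBound`.
    nlinarith [sq_nonneg (‖η‖ - 1)]
  have h3 : inner ℝ (x - Y) ((deriv f ‖x‖ / ‖x‖) • x) ≤ ‖x - Y‖ * |deriv f ‖x‖| := by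
    refine (hcs _).trans (le_of_eq ?_)
    rw [norm_smul, norm_div, norm_norm, Real.norm_eq_abs]
    field_simp
  have h4 : ∑ k, (‖τ k‖ ^ 2 - inner ℝ (x - Y) (modelChristoffel w x (τ k) (τ k)))
      ≤ n * (A * (1 + ‖x - Y‖ * chrBound w ‖x‖)) := by
    refine (Finset.sum_le_sum fun k _ => h1 k).trans (le_of_eq ?_)
    simp
  have h5 : ∑ k, (‖τ k‖ ^ 2 - inner ℝ (x - Y) (modelChristoffel w x (τ k) (τ k)))
      + inner ℝ (x - Y) η + inner ℝ (x - Y) ((deriv f ‖x‖ / ‖x‖) • x)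
      < 2 * α * ∑ k, (inner ℝ (x - Y) (τ k)) ^ 2 := by
    refine lt_of_le_of_lt ?_ hD
    unfold lowerOrderBound
    linarith
  have h6 : ∑ k, (gaussHess α Y x (τ k) (τ k)
          - gaussDeriv α Y x (modelChristoffel w x (τ k) (τ k)))
        + gaussDeriv α Y x η + gaussDeriv α Y x ((deriv f ‖x‖ / ‖x‖) • x)
      = (Real.exp (-α * ‖x - Y‖ ^ 2) * (2 * α)) *
        (2 * α * ∑ k, (inner ℝ (x - Y) (τ k)) ^ 2
          - (∑ k, (‖τ k‖ ^ 2 - inner ℝ (x - Y) (modelChristoffel w x (τ k) (τ k)))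
            + inner ℝ (x - Y) η + inner ℝ (x - Y) ((deriv f ‖x‖ / ‖x‖) • x))) := by
    rw [← sub_sub, ← sub_sub, mul_sub, mul_sub, Finset.mul_sum, ← Finset.sum_sub_distrib,
      Finset.mul_sum]
    simp only [gaussHess, gaussDeriv, smul_apply, add_apply, innerSL_apply_apply, innerCLM_apply, smul_eq_mul,
      ContinuousLinearMap.smulRight_apply, real_inner_self_eq_norm_sq]
    rw [sub_eq_add_neg, sub_eq_add_neg]
    congr 1
    · congr 1
      · exact Finset.sum_congr rfl fun k _ => by ring
      · ring
    · ring
  rw [h6]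
  have := Real.exp_pos (-α * ‖x - Y‖ ^ 2)
  exact mul_pos (by positivity) (by linarith)

end Model

/-! ### The barrier along the immersion, and the case of constant radius. -/

section Barrier

variable {m n : ℕ} {M : Type*} [TopologicalSpace M] [ChartedSpace (Euc m) M]
  {P : Type*} [TopologicalSpace P] [ChartedSpace (Euc n) P]

/-- Curvature at a point is computed in the chart preferred there, whereas the maximum principle
runs in one fixed chart. Tangent vectors from the fixed chart are thus re-expressed in the preferred
one. -/
theorem fderiv_localRep (Φ : Diffeomorph (𝓡 m) (𝓡 m) (Euc m) M ∞) [IsManifold (𝓡 n) ∞ P]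
    {φ : P → M} (hφ : ContMDiff (𝓡 n) (𝓡 m) ∞ φ) (q₀ : P) {y : Euc n}
    (hy : y ∈ (extChartAt (𝓡 n) q₀).target) (e : Euc n) :
    ∃ a : Euc n, fderiv ℝ (localRep (n := n) Φ φ q₀) y e
      = fderiv ℝ (localRep (n := n) Φ φ ((extChartAt (𝓡 n) q₀).symm y))
        (extChartAt (𝓡 n) ((extChartAt (𝓡 n) q₀).symm y) ((extChartAt (𝓡 n) q₀).symm y)) a := by
  set q := (extChartAt (𝓡 n) q₀).symm y with hq
  have h1 : MDifferentiableAt (𝓡 n) (𝓡 n) (extChartAt (𝓡 n) q₀).symm y :=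
    ((contMDiffOn_extChartAt_symm (n := ∞) q₀).contMDiffAt
      ((isOpen_extChartAt_target q₀).mem_nhds hy)).mdifferentiableAt (by simp)
  have hd : MDifferentiableAt (𝓡 n) (𝓡 m) φ q := hφ.mdifferentiableAt (by simp)
  have hs : MDifferentiableAt (𝓡 m) (𝓡 m) Φ.symm (φ q) := Φ.symm.mdifferentiable (by simp) _
  have h2 : HasMFDerivAt (𝓡 n) (𝓡 m) (localRep (n := n) Φ φ q₀) y
      (((mfderiv (𝓡 m) (𝓡 m) Φ.symm (φ q)).comp (mfderiv (𝓡 n) (𝓡 m) φ q)).comp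
        (mfderiv (𝓡 n) (𝓡 n) (extChartAt (𝓡 n) q₀).symm y)) :=
    (hs.hasMFDerivAt.comp q hd.hasMFDerivAt).comp y h1.hasMFDerivAt
  refine ⟨mfderiv (𝓡 n) (𝓡 n) (extChartAt (𝓡 n) q₀).symm y e, ?_⟩
  refine Eq.trans ?_ (mfderiv_symm_mfderiv Φ hφ q _)
  rw [← mfderiv_eq_fderiv]
  exact DFunLike.congr_fun h2.mfderiv e

theorem fderiv_localRep_injective (Φ : Diffeomorph (𝓡 m) (𝓡 m) (Euc m) M ∞)
    {φ : P → M} (hφ : ContMDiff (𝓡 n) (𝓡 m) ∞ φ) (q : P)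
    (himm : Function.Injective (mfderiv (𝓡 n) (𝓡 m) φ q)) :
    Function.Injective (fderiv ℝ (localRep (n := n) Φ φ q) (extChartAt (𝓡 n) q q)) := by
  intro a b hab
  rw [← mfderiv_symm_mfderiv Φ hφ, ← mfderiv_symm_mfderiv Φ hφ] at hab
  apply himm
  rw [← ofCoord_mfderiv_symm Φ (φ q) (mfderiv (𝓡 n) (𝓡 m) φ q a), hab]
  exact ofCoord_mfderiv_symm Φ (φ q) _

theorem IsRadialWeight.hasDerivAt {Φ : Diffeomorph (𝓡 m) (𝓡 m) (Euc m) M ∞} {f : ℝ → ℝ} {h : M → ℝ}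
    (hh : IsRadialWeight Φ f h) {t : ℝ}
    (ht : 0 < t) :
    HasDerivAt f (deriv f t) t :=
  ((hh.contDiff.contDiffAt (Ici_mem_nhds ht)).differentiableAt (by simp)).hasDerivAt

variable [RiemannianBundle (fun p : M => TangentSpace (𝓡 m) p)]
  {w : ℝ → ℝ} {Φ : Diffeomorph (𝓡 m) (𝓡 m) (Euc m) M ∞} {f : ℝ → ℝ} {h : M → ℝ}

theorem coordMetric_mfderiv_symm (Φ : Diffeomorph (𝓡 m) (𝓡 m) (Euc m) M ∞) (p : M)
    (X : TangentSpace (𝓡 m) p) :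
    coordMetric Φ (Φ.symm p) (mfderiv (𝓡 m) (𝓡 m) Φ.symm p X) (mfderiv (𝓡 m) (𝓡 m) Φ.symm p X)
      = ‖X‖ ^ 2 := by
  rw [← real_inner_self_eq_norm_sq]
  refine (inner_ofCoord Φ p _ _).symm.trans ?_
  rw [ofCoord_mfderiv_symm]

theorem IsModel.mfderiv_symm_grad (hM : IsModel w Φ) (hh : IsRadialWeight Φ f h) {p : M}
    (hp : Φ.symm p ≠ 0) :
    mfderiv (𝓡 m) (𝓡 m) Φ.symm p (grad Φ h p)
      = (deriv f ‖Φ.symm p‖ / ‖Φ.symm p‖) • Φ.symm p := by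
  have h1 := hM.grad_comp_radius hp (hh.hasDerivAt (norm_pos_iff.2 hp)) hh.eq
  rw [Φ.apply_symm_apply] at h1
  rw [h1, mfderiv_symm_ofCoord]

variable [IsManifold (𝓡 n) ∞ P]

/-- At a maximum the weighted trace would be nonpositive, but the radial part contributes at least
`w (H_n^h - λ) ≥ 0` and the Gaussian part is strictly positive. Condition `hD` uses a single tangent
vector instead of a frame, so that it is an open condition in a chart. -/
theorem not_isLocalMax_barrier (hM : IsModel w Φ) (hh : IsRadialWeight Φ f h) {lam : ℝ}
    (hlam : 0 ≤ lam) {φ : P → M} (hφ : ContMDiff (𝓡 n) (𝓡 m) ∞ φ) {q : P}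
    (himm : Function.Injective (mfderiv (𝓡 n) (𝓡 m) φ q))
    (hbound : ‖weightedMeanCurvature (n := n) Φ h φ q‖ ≤ lam)
    (hx : Φ.symm (φ q) ≠ 0) (hH : lam ≤ sphereCurvature n w f ‖Φ.symm (φ q)‖)
    {ψ : ℝ → ℝ} (hψ : ∀ t, 0 < t → HasDerivAt ψ (w t) t) {α ε : ℝ} (hα : 0 < α) (hε : 0 < ε)
    (Y : Euc m) (a : Euc n)
    (hD : lowerOrderBound n w f lam Y (Φ.symm (φ q)) * ((1 + angular w ‖Φ.symm (φ q)‖) *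
        ‖fderiv ℝ (localRep (n := n) Φ φ q) (extChartAt (𝓡 n) q q) a‖ ^ 2)
      < 2 * α * inner ℝ (Φ.symm (φ q) - Y)
        (fderiv ℝ (localRep (n := n) Φ φ q) (extChartAt (𝓡 n) q q) a) ^ 2) :
    ¬ IsLocalMax (fun q' => ψ ‖Φ.symm (φ q')‖ + ε * Real.exp (-α * ‖Φ.symm (φ q') - Y‖ ^ 2)) q := by
  intro hmax
  obtain ⟨τ, hτ, hcs, hess⟩ := exists_frame_hessian_nonpos Φ h hφ q himm
    (modelChristoffel w (Φ.symm (φ q))) (hM.christoffel_eq hx)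
  set x := Φ.symm (φ q) with hxdef
  set c := fderiv ℝ (localRep (n := n) Φ φ q) (extChartAt (𝓡 n) q q) a with hc
  have hr : 0 < ‖x‖ := norm_pos_iff.2 hx
  have hw := hM.pos _ hr
  have hp := hM.angular_pos hr
  set η : Euc m := mfderiv (𝓡 m) (𝓡 m) Φ.symm (φ q) (weightedMeanCurvature (n := n) Φ h φ q) with hη
  have hηle : coordMetric Φ x η η ≤ lam ^ 2 := by
    rw [hη, hxdef]
    refine (coordMetric_mfderiv_symm Φ (φ q) _).trans_le ?_
    gcongr
  -- By Cauchy–Schwarz in the frame, one tangent direction not orthogonal to `x - Y` bounds the sum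
  -- of squares from below.
  have hD2 : lowerOrderBound n w f lam Y x < 2 * α * ∑ k, (inner ℝ (x - Y) (τ k)) ^ 2 := by
    have h1 : inner ℝ (x - Y) c ^ 2 ≤ coordMetric Φ x c c * ∑ k, inner ℝ (x - Y) (τ k) ^ 2 :=
      hcs a (innerSL ℝ (x - Y))
    have h2 : coordMetric Φ x c c * ∑ k, inner ℝ (x - Y) (τ k) ^ 2
        ≤ ((1 + angular w ‖x‖) * ‖c‖ ^ 2) * ∑ k, inner ℝ (x - Y) (τ k) ^ 2 :=
      mul_le_mul_of_nonneg_right (hM.coordMetric_le hx c)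
        (Finset.sum_nonneg fun k _ => sq_nonneg _)
    refine lt_of_mul_lt_mul_right (hD.trans_le ?_)
      (show 0 ≤ (1 + angular w ‖x‖) * ‖c‖ ^ 2 by positivity)
    nlinarith [mul_le_mul_of_nonneg_left (h1.trans h2) hα.le]
  have hgrad : mfderiv (𝓡 m) (𝓡 m) Φ.symm (φ q) (grad Φ h (φ q)) = (deriv f ‖x‖ / ‖x‖) • x :=
    hM.mfderiv_symm_grad hh hx
  have h3 := hess (fun x => ψ ‖x‖ + ε * Real.exp (-α * ‖x - Y‖ ^ 2))
    (fun x => radialDeriv w x + ε • gaussDeriv α Y x) (radialHess w x + ε • gaussHess α Y x)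
    (by
      filter_upwards [isOpen_ne.mem_nhds hx] with z hz
      exact (hasFDerivAt_radial hz (hψ _ (norm_pos_iff.2 hz))).add
        ((hasFDerivAt_gauss α Y z).const_mul ε))
    ((hasFDerivAt_radialDeriv hx (hM.hasDerivAt hr)).add
      ((hasFDerivAt_gaussDeriv α Y x).const_smul ε)) hmax
  rw [hgrad] at h3
  have h4 := hM.gauss_hessian_sum_pos (f := f) hx hα Y hτ hηle hD2
  have h5 := hM.radial_hessian_sum (f := f) hx hτ η
  have h6 : -lam ≤ inner ℝ x η / ‖x‖ :=
    (abs_le.1 (abs_le_of_sq_le_sq ((hM.inner_sq_le hx η).trans hηle) hlam)).1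
  have h7 : 0 ≤ w ‖x‖ * (sphereCurvature n w f ‖x‖ + inner ℝ x η / ‖x‖) :=
    mul_nonneg hw.le (by linarith)
  rw [← h5] at h7
  have h8 := mul_pos hε h4
  have h9 : ∑ k, ((radialHess w x + ε • gaussHess α Y x) (τ k) (τ k)
        - (radialDeriv w x + ε • gaussDeriv α Y x) (modelChristoffel w x (τ k) (τ k)))
      = ∑ k, (radialHess w x (τ k) (τ k) - radialDeriv w x (modelChristoffel w x (τ k) (τ k)))
        + ε * ∑ k, (gaussHess α Y x (τ k) (τ k)
          - gaussDeriv α Y x (modelChristoffel w x (τ k) (τ k))) := by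
    rw [Finset.mul_sum, ← Finset.sum_add_distrib]
    refine Finset.sum_congr rfl fun k _ => ?_
    simp only [add_apply, smul_apply, smul_eq_mul]
    ring
  have h10 : ∀ v : Euc m, (radialDeriv w x + ε • gaussDeriv α Y x) v
      = radialDeriv w x v + ε * gaussDeriv α Y x v := fun v => rfl
  rw [h9] at h3
  have h3' : _ + (radialDeriv w x + ε • gaussDeriv α Y x) η
    + (radialDeriv w x + ε • gaussDeriv α Y x) ((deriv f ‖x‖ / ‖x‖) • x) ≤ 0 := h3
  rw [h10, h10] at h3'
  linarith

/-- If the radius is constant on the immersed submanifold, the radial component of the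
weighted mean curvature vector is determined by the curvature of the sphere. -/
theorem radial_weightedMeanCurvature (hM : IsModel w Φ) (hh : IsRadialWeight Φ f h)
    {φ : P → M} (hφ : ContMDiff (𝓡 n) (𝓡 m) ∞ φ) {q : P}
    (himm : Function.Injective (mfderiv (𝓡 n) (𝓡 m) φ q)) {t : ℝ} (ht : 0 < t)
    (hconst : ∀ q', ‖Φ.symm (φ q')‖ = t) :
    inner ℝ (Φ.symm (φ q)) (mfderiv (𝓡 m) (𝓡 m) Φ.symm (φ q)
      (weightedMeanCurvature (n := n) Φ h φ q) : Euc m) / t = - sphereCurvature n w f t := by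
  have hx : Φ.symm (φ q) ≠ 0 := norm_pos_iff.1 (by rw [hconst]; exact ht)
  obtain ⟨τ, hτ, -, hess⟩ := exists_frame_hessian_nonpos Φ h hφ q himm
    (modelChristoffel w (Φ.symm (φ q))) (hM.christoffel_eq hx)
  obtain ⟨ψ, hψ⟩ := exists_primitive hM.smooth.continuousOn
  have hxt := hconst q
  have hgrad := hM.mfderiv_symm_grad hh hx
  set x := Φ.symm (φ q) with hxdef
  have hr : 0 < ‖x‖ := norm_pos_iff.2 hx
  have hw := hM.pos _ hr
  set η : Euc m := mfderiv (𝓡 m) (𝓡 m) Φ.symm (φ q) (weightedMeanCurvature (n := n) Φ h φ q) with hη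
  have h5 := hM.radial_hessian_sum (f := f) hx hτ η
  -- For constant radius every multiple `s ψ(r)`, of either sign, is maximal everywhere; `s = ±1`
  -- turns the inequality into an equality.
  have h1 : ∀ s : ℝ, s * (∑ k, (radialHess w x (τ k) (τ k)
        - radialDeriv w x (modelChristoffel w x (τ k) (τ k)))
      + radialDeriv w x η + radialDeriv w x ((deriv f ‖x‖ / ‖x‖) • x)) ≤ 0 := by
    intro s
    have h3 := hess (fun x => s * ψ ‖x‖) (fun x => s • radialDeriv w x) (s • radialHess w x)
      (by
        filter_upwards [isOpen_ne.mem_nhds hx] with z hz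
        exact (hasFDerivAt_radial hz (hψ _ (norm_pos_iff.2 hz))).const_mul s)
      ((hasFDerivAt_radialDeriv hx (hM.hasDerivAt hr)).const_smul s)
      (by simp only [hconst]; exact isLocalMax_const)
    rw [hgrad] at h3
    have h9 : ∑ k, ((s • radialHess w x) (τ k) (τ k)
          - (s • radialDeriv w x) (modelChristoffel w x (τ k) (τ k)))
        = s * ∑ k, (radialHess w x (τ k) (τ k)
          - radialDeriv w x (modelChristoffel w x (τ k) (τ k))) := by
      rw [Finset.mul_sum]
      refine Finset.sum_congr rfl fun k _ => ?_
      simp only [smul_apply, smul_eq_mul]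
      ring
    rw [h9] at h3
    have h3' : _ + s * radialDeriv w x η + s * radialDeriv w x ((deriv f ‖x‖ / ‖x‖) • x) ≤ 0 := h3
    linarith
  have h2 := h1 1
  have h3 := h1 (-1)
  rw [h5] at h2 h3
  have h4 : w ‖x‖ * (sphereCurvature n w f ‖x‖ + inner ℝ x η / ‖x‖) = 0 := by linarith
  have h6 := (mul_eq_zero.1 h4).resolve_left hw.ne'
  rw [hxt] at h6
  linarith

end Barrier

/-! ### Hopf's strong maximum principle. -/

section StrongMaximum

variable {E E' : Type*} [NormedAddCommGroup E] [NormedSpace ℝ E] [FiniteDimensional ℝ E]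
  [NormedAddCommGroup E'] [InnerProductSpace ℝ E']

/-- Near `y₀` both chords of `F` and its differentials are within `c/4` of the injective `fderiv ℝ F
y₀`, which expands by at least `c`. A chord therefore differs from its differential by at most
`c/2`, less than the lower bound `3c/4`, so the two make an acute angle. -/
theorem exists_quantitative_immersion {F : E → E'} {y₀ : E} (hF : ContDiffAt ℝ 1 F y₀)
    (hinj : Function.Injective (fderiv ℝ F y₀)) {s : Set E} (hs : s ∈ 𝓝 y₀) :
    ∃ δ > 0, ∃ c > 0, Metric.closedBall y₀ δ ⊆ s ∧
      (∀ y ∈ Metric.closedBall y₀ δ, ∀ y' ∈ Metric.closedBall y₀ δ,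
        c * ‖y - y'‖ ≤ ‖F y - F y'‖) ∧
      ∀ y ∈ Metric.closedBall y₀ δ, ∀ y' ∈ Metric.closedBall y₀ δ, y ≠ y' →
        0 < (inner ℝ (F y - F y') (fderiv ℝ F y (y - y')) : ℝ) := by
  obtain ⟨K, hK, hanti⟩ := LinearMap.exists_antilipschitzWith (fderiv ℝ F y₀).toLinearMap
    (LinearMap.ker_eq_bot.2 hinj)
  have hK' : (0 : ℝ) < K := hK
  set c : ℝ := (K : ℝ)⁻¹ with hc
  have hc0 : 0 < c := inv_pos.2 hK'
  have hA : ∀ v, c * ‖v‖ ≤ ‖fderiv ℝ F y₀ v‖ := by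
    intro v
    have h1 := hanti.le_mul_dist v 0
    simp only [dist_zero_right, map_zero] at h1
    rw [hc, inv_mul_le_iff₀ hK']
    exact h1
  have hstrict := (hF.hasStrictFDerivAt (by simp)).isLittleO.def (show 0 < c / 4 by positivity)
  have hcont : ∀ᶠ y in 𝓝 y₀, ‖fderiv ℝ F y - fderiv ℝ F y₀‖ < c / 4 := by
    have h1 : ContinuousAt (fderiv ℝ F) y₀ :=
      (hF.fderiv_right (m := 0) (by simp)).continuousAt
    simpa [dist_eq_norm] using Metric.tendsto_nhds.1 h1 (c / 4) (by positivity)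
  rw [nhds_prod_eq] at hstrict
  obtain ⟨u, hu, hu'⟩ := (Filter.eventually_prod_self_iff (r := fun a b => ‖F a - F b
    - fderiv ℝ F y₀ (a - b)‖ ≤ c / 4 * ‖a - b‖)).1 hstrict
  obtain ⟨δ, hδ, hball⟩ := Metric.nhds_basis_closedBall.mem_iff.1
    (inter_mem (inter_mem hu hcont) hs)
  have happ : ∀ y ∈ Metric.closedBall y₀ δ, ∀ y' ∈ Metric.closedBall y₀ δ,
      ‖F y - F y' - fderiv ℝ F y₀ (y - y')‖ ≤ c / 4 * ‖y - y'‖ :=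
    fun y hy y' hy' => hu' y (hball hy).1.1 y' (hball hy').1.1
  refine ⟨δ, hδ, 3 / 4 * c, by positivity, fun y hy => (hball hy).2, fun y hy y' hy' => ?_,
    fun y hy y' hy' hne => ?_⟩
  · have h1 := happ y hy y' hy'
    have h2 := hA (y - y')
    have h3 := norm_sub_norm_le (fderiv ℝ F y₀ (y - y')) (fderiv ℝ F y₀ (y - y') - (F y - F y'))
    rw [sub_sub_cancel, norm_sub_rev] at h3
    linarith
  · have h1 := happ y hy y' hy'
    have h2 := hA (y - y')
    have hpos : 0 < ‖y - y'‖ := norm_pos_iff.2 (sub_ne_zero.2 hne)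
    have h4 : ‖fderiv ℝ F y (y - y') - fderiv ℝ F y₀ (y - y')‖ ≤ c / 4 * ‖y - y'‖ := by
      have h5 := (fderiv ℝ F y - fderiv ℝ F y₀).le_opNorm (y - y')
      refine h5.trans ?_
      gcongr
      exact (hball hy).1.2.le
    set v := fderiv ℝ F y (y - y') with hv
    have h6 : ‖F y - F y' - v‖ ≤ c / 2 * ‖y - y'‖ := by
      have : F y - F y' - v = (F y - F y' - fderiv ℝ F y₀ (y - y'))
        - (v - fderiv ℝ F y₀ (y - y')) := by abel
      rw [this]
      refine (norm_sub_le _ _).trans ?_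
      linarith
    have h7 : 3 / 4 * c * ‖y - y'‖ ≤ ‖v‖ := by
      have h3 := norm_sub_norm_le (fderiv ℝ F y₀ (y - y')) (fderiv ℝ F y₀ (y - y') - v)
      rw [sub_sub_cancel, norm_sub_rev] at h3
      linarith
    have h8 : inner ℝ (F y - F y') v = inner ℝ (F y - F y' - v) v + ‖v‖ ^ 2 := by
      rw [inner_sub_left (F y - F y'), real_inner_self_eq_norm_sq]
      ring
    have h9 := (abs_le.1 (abs_real_inner_le_norm (F y - F y' - v) v)).1
    have hvpos : 0 < ‖v‖ := lt_of_lt_of_le (by positivity) h7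
    have h10 : ‖F y - F y' - v‖ * ‖v‖ < ‖v‖ ^ 2 := by
      rw [sq]
      refine mul_lt_mul_of_pos_right ?_ hvpos
      have := mul_pos hc0 hpos
      linarith
    rw [h8]
    linarith

/-- Strong maximum principle for the norm along an immersion, assuming that the sums of a function
of the norm and of a Gaussian satisfying a gradient condition have no interior maxima. -/
theorem eventually_norm_eq_of_barrier {F : E → E'} {y₀ : E} {U : Set E} (hU : U ∈ 𝓝 y₀)
    (hF : ∀ y ∈ U, ContDiffAt ℝ 1 F y) (hinj : Function.Injective (fderiv ℝ F y₀)) {t : ℝ}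
    (ht : 0 < t) (hy₀ : ‖F y₀‖ = t) (hle : ∀ y ∈ U, ‖F y‖ ≤ t) {ψ : ℝ → ℝ}
    (hψm : StrictMonoOn ψ (Set.Ioi 0)) (hψc : ContinuousOn ψ (Set.Ioi 0)) {D : E' → E' → ℝ}
    (hD : ∀ Y x, x ≠ 0 → ContinuousAt (D Y) x)
    (hbarrier : ∀ (Y : E') (α ε : ℝ), 0 < α → 0 < ε → ∀ y ∈ U, ∀ e, F y ≠ 0 →
      D Y (F y) * ‖fderiv ℝ F y e‖ ^ 2 < 2 * α * inner ℝ (F y - Y) (fderiv ℝ F y e) ^ 2 →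
      ¬ IsLocalMax (fun y => ψ ‖F y‖ + ε * Real.exp (-α * ‖F y - Y‖ ^ 2)) y) :
    ∀ᶠ y in 𝓝 y₀, ‖F y‖ = t := by
  have hFy₀ := hF y₀ (mem_of_mem_nhds hU)
  have hne₀ : ∀ᶠ y in 𝓝 y₀, F y ≠ 0 :=
    hFy₀.continuousAt.eventually_ne (norm_pos_iff.1 (by rw [hy₀]; exact ht))
  obtain ⟨δ, hδ, c, hc, hsub, hlip, hang⟩ :=
    exists_quantitative_immersion hFy₀ hinj (inter_mem hU hne₀)
  have hFU : ∀ y ∈ Metric.closedBall y₀ δ, ContDiffAt ℝ 1 F y := fun y hy => hF y (hsub hy).1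
  have hFcont : ContinuousOn F (Metric.closedBall y₀ δ) := fun y hy =>
    (hFU y hy).continuousAt.continuousWithinAt
  have hinjOn : ∀ y ∈ Metric.closedBall y₀ δ, ∀ y' ∈ Metric.closedBall y₀ δ, F y = F y' →
      y = y' := by
    intro y hy y' hy' heq
    have h1 := hlip y hy y' hy'
    rw [heq, sub_self, norm_zero] at h1
    have h2 : ‖y - y'‖ ≤ 0 := by nlinarith [norm_nonneg (y - y')]
    exact sub_eq_zero.1 (norm_le_zero_iff.1 h2)
  by_contra hcon
  have hfreq : ∃ᶠ y in 𝓝 y₀, ‖F y‖ ≠ t := Filter.not_eventually.1 hcon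
  -- The margins `δ/2` and `c * (δ/2)` force the contact point nearest to `F y₁` into the open ball
  -- of radius `δ`.
  have hnear : ∀ᶠ y in 𝓝 y₀, y ∈ Metric.ball y₀ (δ / 2) ∧ ‖F y₀ - F y‖ < c * (δ / 2) := by
    refine Filter.Eventually.and (Metric.ball_mem_nhds y₀ (by positivity)) ?_
    have h1 := Metric.tendsto_nhds.1 hFy₀.continuousAt.tendsto (c * (δ / 2)) (by positivity)
    filter_upwards [h1] with y hy
    rwa [dist_comm, dist_eq_norm] at hy
  obtain ⟨y₁, hy₁t, hy₁b, hy₁F⟩ := (hfreq.and_eventually hnear).exists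
  have hy₁c : y₁ ∈ Metric.closedBall y₀ δ :=
    Metric.ball_subset_closedBall (Metric.ball_subset_ball (by linarith) hy₁b)
  -- `z` is the point of the contact set whose image is closest to `F y₁`
  have hZc : IsCompact (Metric.closedBall y₀ δ ∩ {y | ‖F y‖ = t}) := by
    have : IsClosed (Metric.closedBall y₀ δ ∩ {y | ‖F y‖ = t}) :=
      hFcont.norm.preimage_isClosed_of_isClosed Metric.isClosed_closedBall isClosed_singleton
    exact (isCompact_closedBall y₀ δ).of_isClosed_subset this Set.inter_subset_left
  obtain ⟨z, ⟨hzb, hzt⟩, hzmin⟩ := hZc.exists_isMinOn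
    ⟨y₀, Metric.mem_closedBall_self hδ.le, hy₀⟩
    (f := fun y => ‖F y - F y₁‖)
    ((hFcont.mono Set.inter_subset_left).sub continuousOn_const).norm
  have hzmin' : ∀ y ∈ Metric.closedBall y₀ δ, ‖F y‖ = t → ‖F z - F y₁‖ ≤ ‖F y - F y₁‖ :=
    fun y hy hyt => hzmin ⟨hy, hyt⟩
  have hzt' : ‖F z‖ = t := hzt
  have hzy : z ≠ y₁ := by
    rintro rfl
    exact hy₁t hzt
  have hzball : z ∈ Metric.ball y₀ δ := by
    have h1 := hlip z hzb y₁ hy₁c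
    have h2 := hzmin' y₀ (Metric.mem_closedBall_self hδ.le) hy₀
    have h3 : ‖z - y₁‖ < δ / 2 := by
      have : c * ‖z - y₁‖ < c * (δ / 2) := by linarith
      exact lt_of_mul_lt_mul_left this hc.le
    rw [← dist_eq_norm] at h3
    rw [Metric.mem_ball] at hy₁b ⊢
    have := dist_triangle z y₁ y₀
    linarith
  have hzne : F z ≠ 0 := (hsub hzb).2
  -- With the midpoint as centre, the ball through `F z` lies inside the ball about `F y₁` and
  -- touches its boundary only at `F z`. Hence it meets the image of the contact set only there
  -- (`htouch`, by the median identity).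
  set Y : E' := (1 / 2 : ℝ) • (F z + F y₁) with hY
  have hzY : F z - Y = (1 / 2 : ℝ) • (F z - F y₁) := by rw [hY]; module
  have htouch : ∀ y ∈ Metric.closedBall y₀ δ, ‖F y‖ = t → ‖F y - Y‖ ≤ ‖F z - Y‖ → y = z := by
    intro y hy hyt hyY
    have h1 : ‖F y - Y‖ ^ 2 = 1 / 2 * ‖F y - F y₁‖ ^ 2 + 1 / 2 * ‖F y - F z‖ ^ 2
        - 1 / 4 * ‖F z - F y₁‖ ^ 2 := by
      have h2 : F y - Y = (1 / 2 : ℝ) • ((F y - F y₁) + (F y - F z)) := by rw [hY]; module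
      have h3 : F z - F y₁ = (F y - F y₁) - (F y - F z) := by abel
      rw [h2, h3, norm_smul, mul_pow, norm_add_sq_real (F y - F y₁),
        norm_sub_sq_real (F y - F y₁)]
      norm_num
      ring
    have h2 : ‖F z - Y‖ ^ 2 = 1 / 4 * ‖F z - F y₁‖ ^ 2 := by
      rw [hzY, norm_smul, mul_pow]
      norm_num
    have h3 : ‖F z - F y₁‖ ^ 2 ≤ ‖F y - F y₁‖ ^ 2 := by
      gcongr
      exact hzmin' y hy hyt
    have h4 : ‖F y - Y‖ ^ 2 ≤ ‖F z - Y‖ ^ 2 := by gcongr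
    have h5 : ‖F y - F z‖ ^ 2 ≤ 0 := by linarith
    have h6 : ‖F y - F z‖ = 0 := by nlinarith [norm_nonneg (F y - F z)]
    exact hinjOn y hy z hzb (sub_eq_zero.1 (norm_eq_zero.1 h6))
  -- the barrier is effective near `z`
  set e := z - y₁ with he
  have hb₀ : 0 < (inner ℝ (F z - Y) (fderiv ℝ F z e) : ℝ) := by
    rw [hzY, real_inner_smul_left]
    exact mul_pos (by norm_num) (hang z hzb y₁ hy₁c hzy)
  set b₀ : ℝ := inner ℝ (F z - Y) (fderiv ℝ F z e) with hb₀def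
  set κ := D Y (F z) * ‖fderiv ℝ F z e‖ ^ 2 with hκ
  obtain ⟨α, hα, hακ⟩ : ∃ α > 0, κ < 2 * α * b₀ ^ 2 := by
    refine ⟨(|κ| + 1) / (2 * b₀ ^ 2), by positivity, ?_⟩
    have : 2 * ((|κ| + 1) / (2 * b₀ ^ 2)) * b₀ ^ 2 = |κ| + 1 := by field_simp
    rw [this]
    linarith [le_abs_self κ]
  have hev : ∀ᶠ y in 𝓝 z, D Y (F y) * ‖fderiv ℝ F y e‖ ^ 2
      < 2 * α * inner ℝ (F y - Y) (fderiv ℝ F y e) ^ 2 := by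
    have hFz := (hFU z hzb).continuousAt
    have hDF : ContinuousAt (fun y => fderiv ℝ F y e) z :=
      (((hFU z hzb).fderiv_right (m := 0) (by simp)).continuousAt).clm_apply continuousAt_const
    have h1 : ContinuousAt (fun y => D Y (F y) * ‖fderiv ℝ F y e‖ ^ 2) z :=
      (ContinuousAt.comp (f := F) (hD Y (F z) hzne) hFz).mul (hDF.norm.pow 2)
    have h2 : ContinuousAt (fun y => 2 * α * inner ℝ (F y - Y) (fderiv ℝ F y e) ^ 2) z :=
      continuousAt_const.mul (((hFz.sub continuousAt_const).inner hDF).pow 2)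
    exact h1.eventually_lt h2 hακ
  obtain ⟨σ, hσ, hσball⟩ := Metric.nhds_basis_closedBall.mem_iff.1
    (inter_mem (Metric.isOpen_ball.mem_nhds hzball) hev)
  have hσsub : ∀ y ∈ Metric.closedBall z σ, y ∈ Metric.closedBall y₀ δ := fun y hy =>
    Metric.ball_subset_closedBall (hσball hy).1
  have hψF : ContinuousOn (fun y => ψ ‖F y‖) (Metric.closedBall z σ) := by
    refine hψc.comp (hFcont.mono hσsub).norm fun y hy => ?_
    exact norm_pos_iff.2 (hsub (hσsub y hy)).2
  have hsphere : Metric.sphere z σ ⊆ Metric.closedBall z σ := Metric.sphere_subset_closedBall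
  have hSc : IsCompact (Metric.sphere z σ ∩ {y | ‖F y - Y‖ ≤ ‖F z - Y‖}) := by
    have h1 : ContinuousOn (fun y => ‖F y - Y‖) (Metric.sphere z σ) :=
      ((hFcont.mono fun y hy => hσsub y (hsphere hy)).sub continuousOn_const).norm
    exact (isCompact_sphere z σ).of_isClosed_subset
      (h1.preimage_isClosed_of_isClosed Metric.isClosed_sphere isClosed_Iic) Set.inter_subset_left
  -- On the part of the small sphere mapped into the ball about `Y` there is no contact, so by
  -- compactness `ψ‖F y‖ ≤ -a < ψ t`. Half of this gap serves as `ε`.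
  obtain ⟨a, ha, haS⟩ := hSc.exists_forall_le' (f := fun y => -ψ ‖F y‖) (a := -ψ t)
    ((hψF.mono (Set.inter_subset_left.trans hsphere)).neg) (by
      rintro y ⟨hy, hyY⟩
      have hyb := hσsub y (hsphere hy)
      refine neg_lt_neg (hψm (norm_pos_iff.2 (hsub hyb).2) ht
        (lt_of_le_of_ne (hle y (hsub hyb).1) fun hyt => ?_))
      have hyz := htouch y hyb hyt hyY
      rw [hyz, Metric.mem_sphere, dist_self] at hy
      exact hσ.ne hy)
  set ε := (a + ψ t) / 2 with hε
  have hε0 : 0 < ε := by rw [hε]; linarith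
  have hGc : ContinuousOn (fun y => ψ ‖F y‖ + ε * Real.exp (-α * ‖F y - Y‖ ^ 2))
      (Metric.closedBall z σ) := by
    refine hψF.add (continuousOn_const.mul (Real.continuous_exp.comp_continuousOn ?_))
    exact continuousOn_const.mul
      ((((hFcont.mono hσsub).sub continuousOn_const).norm).pow 2)
  obtain ⟨y, hy, hymax⟩ := (isCompact_closedBall z σ).exists_isMaxOn
    ⟨z, Metric.mem_closedBall_self hσ.le⟩ hGc
  have hzy' := hymax (Metric.mem_closedBall_self hσ.le)
  simp only [Set.mem_ofPred_eq, hzt'] at hzy'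
  have hyb := hσsub y hy
  have hyt : ψ ‖F y‖ ≤ ψ t :=
    hψm.monotoneOn (norm_pos_iff.2 (hsub hyb).2) ht (hle y (hsub hyb).1)
  -- On the boundary the sum lies below its value at `z`: inside the ball about `Y` the gap in `ψ`
  -- exceeds `ε`, and outside it the Gaussian is smaller than at `z`. So the maximum is interior.
  have hint : y ∈ Metric.ball z σ := by
    by_contra hnot
    have hys : y ∈ Metric.sphere z σ :=
      le_antisymm (Metric.mem_closedBall.1 hy) (not_lt.1 hnot)
    have hexp := Real.exp_pos (-α * ‖F z - Y‖ ^ 2)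
    rcases le_or_gt ‖F y - Y‖ ‖F z - Y‖ with hyY | hyY
    · have h1 : a ≤ -ψ ‖F y‖ := haS y ⟨hys, hyY⟩
      have h2 : Real.exp (-α * ‖F y - Y‖ ^ 2) ≤ 1 := by
        rw [Real.exp_le_one_iff]
        nlinarith [sq_nonneg ‖F y - Y‖]
      have h3 : ε * Real.exp (-α * ‖F y - Y‖ ^ 2) ≤ ε := by nlinarith
      have h4 := mul_pos hε0 hexp
      rw [hε] at h3 h4 hzy'
      linarith
    · have h1 : Real.exp (-α * ‖F y - Y‖ ^ 2) < Real.exp (-α * ‖F z - Y‖ ^ 2) := by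
        rw [Real.exp_lt_exp]
        have : ‖F z - Y‖ ^ 2 < ‖F y - Y‖ ^ 2 := by gcongr
        nlinarith
      have := mul_lt_mul_of_pos_left h1 hε0
      linarith
  have hlocmax : IsLocalMax (fun y => ψ ‖F y‖ + ε * Real.exp (-α * ‖F y - Y‖ ^ 2)) y :=
    hymax.isLocalMax (Filter.mem_of_superset (Metric.isOpen_ball.mem_nhds hint)
      Metric.ball_subset_closedBall)
  exact hbarrier Y α ε hα hε0 y (hsub hyb).1 e (hsub hyb).2 (hσball hy).2 hlocmax

end StrongMaximum

/-! ### Compactness of `P` and continuity of the barrier's constants. -/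

section Ambient

variable {m n : ℕ} {M : Type*} [TopologicalSpace M] [ChartedSpace (Euc m) M]

theorem compactSpace_of_isProperMap {P : Type*} [TopologicalSpace P]
    (Φ : Diffeomorph (𝓡 m) (𝓡 m) (Euc m) M ∞) {φ : P → M}
    (hproper : IsProperMap φ) {t₀ : ℝ} (hball : Set.range φ ⊆ closedBall Φ t₀) :
    CompactSpace P := by
  have h1 : IsCompact (closedBall Φ t₀) := by
    have : closedBall Φ t₀ = Φ '' Metric.closedBall (0 : Euc m) t₀ := by
      ext p
      constructor
      · intro hp
        exact ⟨Φ.symm p, mem_closedBall_zero_iff.2 hp, Φ.apply_symm_apply p⟩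
      · rintro ⟨x, hx, rfl⟩
        simpa [closedBall, radius] using hx
    rw [this]
    exact (isCompact_closedBall _ _).image Φ.continuous
  refine ⟨?_⟩
  have h2 : φ ⁻¹' closedBall Φ t₀ = Set.univ := Set.eq_univ_of_forall fun q => hball ⟨q, rfl⟩
  rw [← h2]
  exact hproper.isCompact_preimage h1

variable [RiemannianBundle (fun p : M => TangentSpace (𝓡 m) p)]
  {w : ℝ → ℝ} {Φ : Diffeomorph (𝓡 m) (𝓡 m) (Euc m) M ∞} {f : ℝ → ℝ} {h : M → ℝ}

theorem IsModel.continuousAt_lowerOrderBound (hM : IsModel w Φ) (hh : IsRadialWeight Φ f h)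
    (lam : ℝ) (Y : Euc m) {x : Euc m} (hx : x ≠ 0) :
    ContinuousAt (fun x => lowerOrderBound n w f lam Y x * (1 + angular w ‖x‖)) x := by
  have hr : 0 < ‖x‖ := norm_pos_iff.2 hx
  have hnorm : ContinuousAt (fun x : Euc m => ‖x‖) x := continuous_norm.continuousAt
  have hw : ContinuousAt w ‖x‖ := (hM.hasDerivAt hr).continuousAt
  have hw' : ContinuousAt (deriv w) ‖x‖ :=
    ((hM.smooth.deriv_of_isOpen (m := 0) isOpen_Ioi (by simp)).continuousOn).continuousAt
      (Ioi_mem_nhds hr)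
  have hf' : ContinuousAt (deriv f) ‖x‖ :=
    (((hh.contDiff.mono Set.Ioi_subset_Ici_self).deriv_of_isOpen (m := 0) isOpen_Ioi
      (by simp)).continuousOn).continuousAt (Ioi_mem_nhds hr)
  have hid : ContinuousAt (fun t : ℝ => t) ‖x‖ := continuousAt_id
  have hp : ContinuousAt (angular w) ‖x‖ :=
    (hw.pow 2).div (hid.pow 2) (pow_pos hr 2).ne'
  have hc : ContinuousAt (chrC w) ‖x‖ :=
    ((hw'.div hw (hM.pos _ hr).ne').sub (continuousAt_const.div hid hr.ne')).div hid hr.ne'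
  have hk : ContinuousAt (chrK w) ‖x‖ :=
    (((hp.mul hc).neg.div (hid.pow 2) (pow_pos hr 2).ne').sub
      ((continuousAt_const.sub hp).div (hid.pow 4) (pow_pos hr 4).ne')).sub
      ((continuousAt_const.mul ((continuousAt_const.sub hp).div (hid.pow 2) (pow_pos hr 2).ne')).mul hc)
  have hl : ContinuousAt (chrL w) ‖x‖ :=
    ((continuousAt_const.sub hp).div (hid.pow 2) (pow_pos hr 2).ne').sub (hp.mul hc)
  have hb : ContinuousAt (chrBound w) ‖x‖ :=
    ((continuousAt_const.mul hc.abs).mul hid).add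
      (((hk.abs.mul (hid.pow 2)).add hl.abs).mul hid)
  have hpx : ContinuousAt (fun x : Euc m => angular w ‖x‖) x :=
    ContinuousAt.comp (f := fun x : Euc m => ‖x‖) hp hnorm
  have hbx : ContinuousAt (fun x : Euc m => chrBound w ‖x‖) x :=
    ContinuousAt.comp (f := fun x : Euc m => ‖x‖) hb hnorm
  have hfx : ContinuousAt (fun x : Euc m => deriv f ‖x‖) x :=
    ContinuousAt.comp (f := fun x : Euc m => ‖x‖) hf' hnorm
  have hYx : ContinuousAt (fun x : Euc m => ‖x - Y‖) x := by fun_prop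
  have hAx : ContinuousAt (fun x : Euc m => 1 + 1 / angular w ‖x‖) x :=
    continuousAt_const.add (continuousAt_const.div hpx (hM.angular_pos hr).ne')
  exact (((continuousAt_const.mul (hAx.mul (continuousAt_const.add (hYx.mul hbx)))).add
    (hYx.mul (continuousAt_const.add (hAx.mul continuousAt_const)))).add (hYx.mul hfx.abs)).mul
    (continuousAt_const.add hpx)

end Ambient

/-! ### Hypersurfaces in spheres, constancy of the radius, and the equality case. -/

section Immersion

variable {m n : ℕ} {M : Type*} [TopologicalSpace M] [ChartedSpace (Euc m) M]
  {P : Type*} [TopologicalSpace P] [ChartedSpace (Euc n) P]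

variable [IsManifold (𝓡 n) ∞ P]

/-- The image of an immersed hypersurface contained in a centred sphere is open in that sphere. -/
theorem eventually_mem_range_of_norm_eq (Φ : Diffeomorph (𝓡 m) (𝓡 m) (Euc m) M ∞) (hnm : n + 1 = m)
    {φ : P → M} (hφ : ContMDiff (𝓡 n) (𝓡 m) ∞ φ) (q : P)
    (himm : Function.Injective (mfderiv (𝓡 n) (𝓡 m) φ q)) {t : ℝ} (ht : 0 < t)
    (hconst : ∀ q', ‖Φ.symm (φ q')‖ = t) :
    ∀ᶠ x in 𝓝 (Φ.symm (φ q)), ‖x‖ = t → x ∈ Set.range fun q' => Φ.symm (φ q') := by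
  set F := localRep (n := n) Φ φ q with hF
  set y := extChartAt (𝓡 n) q q with hy
  have hFy : F y = Φ.symm (φ q) := by simp [hF, hy, localRep]
  have hFn : ∀ z, ‖F z‖ = t := fun z => hconst _
  have hFc : ContDiffAt ℝ ∞ F y := localRep_contDiffAt Φ hφ q y (mem_extChartAt_target q)
  have hinj : Function.Injective (fderiv ℝ F y) := fderiv_localRep_injective Φ hφ q himm
  have hFs : HasStrictFDerivAt F (fderiv ℝ F y) y := hFc.hasStrictFDerivAt (by simp)
  have horth : ∀ a, (inner ℝ (F y) (fderiv ℝ F y a) : ℝ) = 0 := by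
    intro a
    have h1 := hFs.hasFDerivAt.norm_sq
    have h2 : (fun z => ‖F z‖ ^ 2) = fun _ => t ^ 2 := by funext z; rw [hFn]
    rw [h2] at h1
    have h3 := DFunLike.congr_fun (h1.unique (hasFDerivAt_const (t ^ 2) y)) a
    simpa using h3
  -- The cone map `(s, z) ↦ s F(z)` has invertible differential at `(1, y)`, because `F y` is
  -- orthogonal to the image of `fderiv ℝ F y` and dimensions match. It is therefore open there, and
  -- an image point of norm `t` with `s > 0` has `s = 1`.
  have h1 : HasStrictFDerivAt (fun p : ℝ × Euc n => p.1 • F p.2)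
      ((1 : ℝ) • (fderiv ℝ F y).comp (ContinuousLinearMap.snd ℝ ℝ (Euc n))
        + (ContinuousLinearMap.fst ℝ ℝ (Euc n)).smulRight (F y)) ((1 : ℝ), y) := by
    have hs : HasStrictFDerivAt (fun p : ℝ × Euc n => F p.2)
        ((fderiv ℝ F y).comp (ContinuousLinearMap.snd ℝ ℝ (Euc n))) ((1 : ℝ), y) :=
      HasStrictFDerivAt.comp ((1 : ℝ), y) hFs hasStrictFDerivAt_snd
    exact hasStrictFDerivAt_fst.smul hs
  set L : ℝ × Euc n →L[ℝ] Euc m := (1 : ℝ) • (fderiv ℝ F y).comp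
    (ContinuousLinearMap.snd ℝ ℝ (Euc n)) + (ContinuousLinearMap.fst ℝ ℝ (Euc n)).smulRight (F y)
    with hL
  have hLapp : ∀ s a, L (s, a) = fderiv ℝ F y a + s • F y := fun s a => by simp [hL]
  have hLinj : Function.Injective L := by
    refine (injective_iff_map_eq_zero L).2 ?_
    rintro ⟨s, a⟩ h0
    rw [hLapp] at h0
    have h2 : (inner ℝ (F y) (fderiv ℝ F y a + s • F y) : ℝ) = s * t ^ 2 := by
      rw [inner_add_right, horth, real_inner_smul_right, real_inner_self_eq_norm_sq, hFn]
      ring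
    rw [h0, inner_zero_right] at h2
    have hs : s = 0 := by
      rcases mul_eq_zero.1 h2.symm with h | h
      · exact h
      · exact absurd h (by positivity)
    rw [hs, zero_smul, add_zero] at h0
    have ha : a = 0 := hinj (h0.trans (map_zero _).symm)
    rw [hs, ha]
    rfl
  have hLsurj : Function.Surjective L :=
    (LinearMap.injective_iff_surjective_of_finrank_eq_finrank (f := L.toLinearMap)
      (by simp [← hnm, add_comm])).1 hLinj
  have hmap := h1.map_nhds_eq_of_surj (LinearMap.range_eq_top.2 hLsurj)
  simp only [one_smul] at hmap
  rw [← hFy, ← hmap, Filter.eventually_map]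
  have hpos : ∀ᶠ p : ℝ × Euc n in 𝓝 ((1 : ℝ), y), 0 < p.1 :=
    continuous_fst.continuousAt.eventually (Ioi_mem_nhds one_pos)
  filter_upwards [hpos] with p hp hpt
  rw [norm_smul, hFn, Real.norm_of_nonneg hp.le] at hpt
  have : p.1 = 1 := by
    have := mul_right_cancel₀ ht.ne' (hpt.trans (one_mul t).symm)
    exact this
  rw [this, one_smul]
  exact ⟨(extChartAt (𝓡 n) q).symm p.2, rfl⟩

theorem sphere_subset_range [CompactSpace P] [Nonempty P]
    (Φ : Diffeomorph (𝓡 m) (𝓡 m) (Euc m) M ∞) (hn : 1 ≤ n) (hnm : n + 1 = m)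
    {φ : P → M} (hφ : ContMDiff (𝓡 n) (𝓡 m) ∞ φ)
    (himm : ∀ q, Function.Injective (mfderiv (𝓡 n) (𝓡 m) φ q)) {t : ℝ} (ht : 0 < t)
    (hconst : ∀ q, ‖Φ.symm (φ q)‖ = t) : sphere Φ t ⊆ Set.range φ := by
  set A := Set.range fun q => Φ.symm (φ q) with hA
  have hAc : IsClosed A :=
    (isCompact_range (Φ.symm.continuous.comp hφ.continuous)).isClosed
  -- Connectedness of the sphere needs `m ≥ 2`, which is where `1 ≤ n` enters.
  have hrank : 1 < Module.rank ℝ (Euc m) := by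
    rw [← Module.finrank_eq_rank, finrank_euclideanSpace, Fintype.card_fin]
    exact_mod_cast (by omega : 1 < m)
  have hconn := isPreconnected_sphere hrank (0 : Euc m) t
  have hsub : Metric.sphere (0 : Euc m) t ⊆ A := by
    have hcover : Metric.sphere (0 : Euc m) t ⊆ interior {x | ‖x‖ = t → x ∈ A} ∪ Aᶜ := by
      intro x hx
      by_cases hxA : x ∈ A
      · left
        obtain ⟨q, rfl⟩ := hxA
        exact mem_interior_iff_mem_nhds.2
          (eventually_mem_range_of_norm_eq Φ hnm hφ q (himm q) ht hconst)
      · exact Or.inr hxA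
    have hdisj : Metric.sphere (0 : Euc m) t ∩ (interior {x | ‖x‖ = t → x ∈ A} ∩ Aᶜ) = ∅ := by
      ext x
      simp only [Set.mem_inter_iff, Set.mem_empty_iff_false, iff_false]
      rintro ⟨hx, hx1, hx2⟩
      exact hx2 (interior_subset hx1 (mem_sphere_zero_iff_norm.1 hx))
    rcases isPreconnected_iff_subset_of_disjoint.1 hconn _ _ isOpen_interior hAc.isOpen_compl
      hcover hdisj with h | h
    · intro x hx
      exact (interior_subset (h hx)) (mem_sphere_zero_iff_norm.1 hx)
    · obtain ⟨q⟩ := ‹Nonempty P›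
      exact absurd ⟨q, rfl⟩ (h (mem_sphere_zero_iff_norm.2 (hconst q)))
  intro p hp
  obtain ⟨q, hq⟩ := hsub (mem_sphere_zero_iff_norm.2 hp : Φ.symm p ∈ Metric.sphere (0 : Euc m) t)
  exact ⟨q, Φ.symm.injective hq⟩

variable [RiemannianBundle (fun p : M => TangentSpace (𝓡 m) p)]
  {w : ℝ → ℝ} {Φ : Diffeomorph (𝓡 m) (𝓡 m) (Euc m) M ∞} {f : ℝ → ℝ} {h : M → ℝ}

/-- Strong maximum principle for the distance to the pole on a submanifold whose weighted mean
curvature is bounded by that of the spheres. -/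
theorem eventually_radius_eq (hM : IsModel w Φ) (hh : IsRadialWeight Φ f h) {lam : ℝ}
    (hlam : 0 ≤ lam) {φ : P → M} (hφ : ContMDiff (𝓡 n) (𝓡 m) ∞ φ)
    (himm : ∀ q, Function.Injective (mfderiv (𝓡 n) (𝓡 m) φ q))
    (hbound : ∀ q, ‖weightedMeanCurvature (n := n) Φ h φ q‖ ≤ lam) {t : ℝ} (ht : 0 < t)
    (hH : ∀ s, 0 < s → s ≤ t → lam ≤ sphereCurvature n w f s)
    (hle : ∀ q, ‖Φ.symm (φ q)‖ ≤ t) {q₀ : P} (hq₀ : ‖Φ.symm (φ q₀)‖ = t) :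
    ∀ᶠ q in 𝓝 q₀, ‖Φ.symm (φ q)‖ = t := by
  obtain ⟨ψ, hψ⟩ := exists_primitive hM.smooth.continuousOn
  have hψm : StrictMonoOn ψ (Set.Ioi 0) := by
    refine strictMonoOn_of_deriv_pos (convex_Ioi 0)
      (fun s hs => (hψ s hs).continuousAt.continuousWithinAt) fun s hs => ?_
    rw [interior_Ioi] at hs
    rw [(hψ s hs).deriv]
    exact hM.pos s hs
  have hF0 : localRep (n := n) Φ φ q₀ (extChartAt (𝓡 n) q₀ q₀) = Φ.symm (φ q₀) := by
    simp [localRep]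
  have hmain : ∀ᶠ y in 𝓝 (extChartAt (𝓡 n) q₀ q₀), ‖localRep (n := n) Φ φ q₀ y‖ = t := by
    refine eventually_norm_eq_of_barrier (extChartAt_target_mem_nhds q₀)
      (fun y hy => (localRep_contDiffAt Φ hφ q₀ y hy).of_le
        (WithTop.coe_le_coe.2 (le_top : (1 : ℕ∞) ≤ ⊤)))
      (fderiv_localRep_injective Φ hφ q₀ (himm q₀)) ht (by rw [hF0, hq₀]) (fun y _ => hle _) hψm
      (fun s hs => (hψ s hs).continuousAt.continuousWithinAt)
      (D := fun Y x => lowerOrderBound n w f lam Y x * (1 + angular w ‖x‖))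
      (fun Y x hx => hM.continuousAt_lowerOrderBound hh lam Y hx) ?_
    intro Y α ε hα hε y hy e hne hlt hmax
    obtain ⟨a, ha⟩ := fderiv_localRep Φ hφ q₀ hy e
    rw [ha, mul_assoc] at hlt
    refine not_isLocalMax_barrier hM hh hlam hφ (himm _) (hbound _) hne
      (hH _ (norm_pos_iff.2 hne) (hle _)) hψ hα hε Y a hlt ?_
    have hq : (extChartAt (𝓡 n) q₀).symm y ∈ (extChartAt (𝓡 n) q₀).source :=
      (extChartAt (𝓡 n) q₀).map_target hy
    have hcont := (continuousAt_extChartAt' (I := 𝓡 n) hq).tendsto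
    rw [(extChartAt (𝓡 n) q₀).right_inv hy] at hcont
    have h1 : ∀ᶠ z in 𝓝 y, ψ ‖localRep (n := n) Φ φ q₀ z‖
        + ε * Real.exp (-α * ‖localRep (n := n) Φ φ q₀ z - Y‖ ^ 2)
        ≤ ψ ‖localRep (n := n) Φ φ q₀ y‖
        + ε * Real.exp (-α * ‖localRep (n := n) Φ φ q₀ y - Y‖ ^ 2) := hmax
    filter_upwards [hcont.eventually h1, extChartAt_source_mem_nhds' (I := 𝓡 n) hq] with q' h2 h3
    simpa only [localRep, (extChartAt (𝓡 n) q₀).left_inv h3] using h2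
  filter_upwards [(continuousAt_extChartAt (I := 𝓡 n) q₀).tendsto.eventually hmain,
    extChartAt_source_mem_nhds (I := 𝓡 n) q₀] with q h1 h2
  simpa only [localRep, (extChartAt (𝓡 n) q₀).left_inv h2] using h1

theorem exists_radius_eq [CompactSpace P] [ConnectedSpace P] (hn : 1 ≤ n)
    (hM : IsModel w Φ) (hh : IsRadialWeight Φ f h) {lam t₀ : ℝ}
    (hlam : 0 ≤ lam) (hH : ∀ s, 0 < s → s ≤ t₀ → lam ≤ sphereCurvature n w f s)
    {φ : P → M} (hφ : ContMDiff (𝓡 n) (𝓡 m) ∞ φ)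
    (himm : ∀ q, Function.Injective (mfderiv (𝓡 n) (𝓡 m) φ q))
    (hball : Set.range φ ⊆ closedBall Φ t₀)
    (hbound : ∀ q, ‖weightedMeanCurvature (n := n) Φ h φ q‖ ≤ lam) :
    ∃ t, 0 < t ∧ t ≤ t₀ ∧ ∀ q, ‖Φ.symm (φ q)‖ = t := by
  have hcont : Continuous fun q => ‖Φ.symm (φ q)‖ :=
    (Φ.symm.continuous.comp hφ.continuous).norm
  obtain ⟨q₀, -, hq₀⟩ := isCompact_univ.exists_isMaxOn Set.univ_nonempty hcont.continuousOn
  have hle : ∀ q, ‖Φ.symm (φ q)‖ ≤ ‖Φ.symm (φ q₀)‖ := fun q => hq₀ (Set.mem_univ q)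
  -- A zero maximum would make `φ` constant, with zero differential, contradicting injectivity in
  -- dimension `n ≥ 1`.
  have ht : 0 < ‖Φ.symm (φ q₀)‖ := by
    by_contra! hneg
    have h0 : ∀ q, φ q = Φ 0 := fun q => by
      have h1 : Φ.symm (φ q) = 0 := norm_le_zero_iff.1 ((hle q).trans hneg)
      rw [← h1, Φ.apply_symm_apply]
    have h2 : φ = fun _ => Φ 0 := funext h0
    let v : Euc n := stdVec ⟨0, hn⟩
    have h3 : v ≠ 0 := by
      intro h4
      have := congrArg (fun u : Euc n => u ⟨0, hn⟩) h4
      simp [v, stdVec] at this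
    have h5 : mfderiv (𝓡 n) (𝓡 m) φ q₀ = 0 := by
      rw [h2]; exact mfderiv_const
    refine h3 (himm q₀ (a₁ := v) (a₂ := (0 : Euc n)) ?_)
    rw [h5]
    rfl
  refine ⟨_, ht, hball ⟨q₀, rfl⟩, ?_⟩
  have hclopen : IsClopen {q | ‖Φ.symm (φ q)‖ = ‖Φ.symm (φ q₀)‖} := by
    refine ⟨isClosed_eq hcont continuous_const, isOpen_iff_mem_nhds.2 fun q hq => ?_⟩
    exact eventually_radius_eq hM hh hlam hφ himm hbound ht
      (fun s hs hst => hH s hs (hst.trans (hball ⟨q₀, rfl⟩))) hle hq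
  have huniv := hclopen.eq_univ ⟨q₀, rfl⟩
  exact fun q => (huniv ▸ Set.mem_univ q : q ∈ {q | ‖Φ.symm (φ q)‖ = ‖Φ.symm (φ q₀)‖})

/-- The unit vector `G = ∇r` satisfies `⟨G, X⟩ = -H_n^h(t)`, so Cauchy–Schwarz gives `H_n^h(t) ≤ ‖X‖
≤ λ`, hence equality. Then `‖X + λG‖² = ‖X‖² - λ² ≤ 0`. -/
theorem sphereCurvature_eq_and_weightedMeanCurvature_eq (hM : IsModel w Φ)
    (hh : IsRadialWeight Φ f h) {lam : ℝ} {φ : P → M}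
    (hφ : ContMDiff (𝓡 n) (𝓡 m) ∞ φ) {q : P}
    (himm : Function.Injective (mfderiv (𝓡 n) (𝓡 m) φ q))
    (hbound : ‖weightedMeanCurvature (n := n) Φ h φ q‖ ≤ lam) {t : ℝ} (ht : 0 < t)
    (hH : lam ≤ sphereCurvature n w f t) (hconst : ∀ q', ‖Φ.symm (φ q')‖ = t) :
    sphereCurvature n w f t = lam ∧
      weightedMeanCurvature (n := n) Φ h φ q = -lam • grad Φ (radius Φ) (φ q) := by
  have hrad := radial_weightedMeanCurvature hM hh hφ himm ht hconst
  have hxt := hconst q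
  have hx : Φ.symm (φ q) ≠ 0 := norm_pos_iff.1 (by rw [hxt]; exact ht)
  have hgrad : grad Φ (radius Φ) (φ q) = ofCoord Φ (φ q) ((1 / t) • Φ.symm (φ q)) := by
    have h1 := hM.grad_comp_radius hx (hasDerivAt_id _) (h := radius Φ) (fun p => rfl)
    rwa [Φ.apply_symm_apply, hxt] at h1
  set X := weightedMeanCurvature (n := n) Φ h φ q with hX
  set G := grad Φ (radius Φ) (φ q) with hG
  have hXc : ofCoord Φ (φ q) (mfderiv (𝓡 m) (𝓡 m) Φ.symm (φ q) X) = X :=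
    ofCoord_mfderiv_symm Φ (φ q) X
  have hinner : ∀ v : Euc m, inner ℝ G (ofCoord Φ (φ q) v) = inner ℝ (Φ.symm (φ q)) v / t := by
    intro v
    rw [hgrad, inner_ofCoord, hM.coordMetric_eq hx]
    simp only [real_inner_smul_left, real_inner_smul_right, real_inner_self_eq_norm_sq]
    rw [hxt]
    field_simp
    ring
  have hGX : inner ℝ G X = -sphereCurvature n w f t := by
    have h1 := hinner (mfderiv (𝓡 m) (𝓡 m) Φ.symm (φ q) X)
    rw [hXc] at h1
    rw [h1]
    exact hrad
  have hGG : ‖G‖ ^ 2 = 1 := by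
    rw [← real_inner_self_eq_norm_sq]
    have h1 := hinner ((1 / t) • Φ.symm (φ q))
    rw [← hgrad] at h1
    rw [h1, real_inner_smul_right, real_inner_self_eq_norm_sq, hxt]
    field_simp
  have hG1 : ‖G‖ = 1 := (pow_eq_one_iff_of_nonneg (norm_nonneg G) two_ne_zero).1 hGG
  have hHle : sphereCurvature n w f t ≤ lam := by
    have h1 := (abs_le.1 (abs_real_inner_le_norm G X)).1
    rw [hGX, hG1, one_mul] at h1
    linarith
  have heq := le_antisymm hHle hH
  refine ⟨heq, ?_⟩
  have h2 : ‖X + lam • G‖ ^ 2 ≤ 0 := by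
    rw [norm_add_sq_real, real_inner_smul_right, real_inner_comm, hGX, heq, norm_smul, mul_pow,
      hGG, Real.norm_eq_abs, sq_abs]
    have : ‖X‖ ^ 2 ≤ lam ^ 2 := by gcongr
    linarith
  have h3 : X + lam • G = 0 := by
    rw [← norm_eq_zero]
    nlinarith [norm_nonneg (X + lam • G)]
  rw [neg_smul]
  exact eq_neg_of_add_eq_zero_left h3

end Immersion

end ModelSpace

end

theorem theorem4p2 {m n : ℕ} (hn : 1 ≤ n) (hnm : n < m)
    -- the model space `M` with warping function `w`
    {M : Type*} [TopologicalSpace M] [ChartedSpace (Euc m) M] [IsManifold (𝓡 m) ∞ M]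
    [RiemannianBundle (fun p : M => TangentSpace (𝓡 m) p)]
    [IsContMDiffRiemannianBundle (𝓡 m) ∞ (Euc m) (fun p : M => TangentSpace (𝓡 m) p)]
    (w : ℝ → ℝ) (Φ : Diffeomorph (𝓡 m) (𝓡 m) (Euc m) M ∞) (hM : ModelSpace.IsModel w Φ)
    -- the radial weight `e^h`, `h = f(r)`
    (f : ℝ → ℝ) (h : M → ℝ) (hh : ModelSpace.IsRadialWeight Φ f h)
    (lam t₀ : ℝ) (hlam : 0 ≤ lam) (ht₀ : 0 < t₀)
    (hH : ∀ t, 0 < t → t ≤ t₀ → lam ≤ ModelSpace.sphereCurvature n w f t)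
    -- the properly immersed submanifold `φ : P → M`
    {P : Type*} [TopologicalSpace P] [T2Space P] [SecondCountableTopology P] [ConnectedSpace P]
    [ChartedSpace (Euc n) P] [IsManifold (𝓡 n) ∞ P]
    (φ : P → M) (hφ : ContMDiff (𝓡 n) (𝓡 m) ∞ φ)
    (himm : ∀ q, Function.Injective (mfderiv (𝓡 n) (𝓡 m) φ q))
    (hproper : IsProperMap φ)
    (hball : Set.range φ ⊆ ModelSpace.closedBall Φ t₀)
    (hbound : ∀ q, ‖ModelSpace.weightedMeanCurvature (n := n) Φ h φ q‖ ≤ lam) :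
    (∃ t, 0 < t ∧ t ≤ t₀ ∧ ModelSpace.sphereCurvature n w f t = lam ∧
      Set.range φ ⊆ ModelSpace.sphere Φ t ∧
      (∀ q, ModelSpace.weightedMeanCurvature (n := n) Φ h φ q =
        -lam • ModelSpace.grad Φ (ModelSpace.radius Φ) (φ q)) ∧
      (n + 1 = m → Set.range φ = ModelSpace.sphere Φ t)) ∧
    (AntitoneOn (ModelSpace.sphereCurvature n w f) (Set.Ioi 0) →
      (∀ t, 0 < t → (ModelSpace.sphereCurvature n w f t = lam ↔ t = t₀)) →
      Set.range φ ⊆ ModelSpace.sphere Φ t₀ ∧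
      (n + 1 = m → Set.range φ = ModelSpace.sphere Φ t₀)) := by
  have hP : CompactSpace P := ModelSpace.compactSpace_of_isProperMap Φ hproper hball
  obtain ⟨t, ht, htt₀, hconst⟩ :=
    ModelSpace.exists_radius_eq hn hM hh hlam hH hφ himm hball hbound
  have hcurv := fun q => ModelSpace.sphereCurvature_eq_and_weightedMeanCurvature_eq hM hh hφ
    (himm q) (hbound q) ht (hH t ht htt₀) hconst
  obtain ⟨q₀⟩ : Nonempty P := inferInstance
  have heq := (hcurv q₀).1
  have hsub : Set.range φ ⊆ ModelSpace.sphere Φ t := by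
    rintro _ ⟨q, rfl⟩
    exact hconst q
  have hsphere : n + 1 = m → Set.range φ = ModelSpace.sphere Φ t := fun hm =>
    hsub.antisymm (ModelSpace.sphere_subset_range Φ hn hm hφ himm ht hconst)
  refine ⟨⟨t, ht, htt₀, heq, hsub, fun q => (hcurv q).2, hsphere⟩, fun _ huniq => ?_⟩
  obtain rfl : t = t₀ := (huniq t ht).1 heq
  exact ⟨hsub, hsphere⟩
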